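/- Let $1\le p,q\le\infty$, let $n_1,\dots,n_k\ge 1$ be natural numbers, and let $d$ be their least common multiple. For an operator space $V$ (a closed subspace of some $B(H)$, with $M_r[V]\subseteq B(\ell_2^r\otimes H)$) put $M_n[V]=M_n\otimes_{\min}V$ and $S_1^n[V]=S_1^n\,\widehat\otimes\,V$ (operator space projective tensor product), where $S_1^n=M_n^*$ through the pairing $\langle A,B\rangle=\operatorname{tr}(AB^t)$. Define by complex interpolation $$S_q^n[V]=\big(M_n[V],S_1^n[V]\big)_{1/q},\qquad \ell_p^N[V]=\big(\ell_\infty^N[V],\ell_1^N[V]\big)_{1/p},$$ $$S_p^{n_1}[V]\oplus_p\cdots\oplus_p S_p^{n_k}[V]=\Big(M_{n_1}[V]\oplus_\infty\cdots\oplus_\infty M_{n_k}[V],\;S_1^{n_1}[V]\oplus_1\cdots\oplus_1S_1^{n_k}[V]\Big)_{1/p},$$ with the operator space structures $M_r[(V_0,V_1)_\theta]=(M_r[V_0],M_r[V_1])_\theta$, and omit $[V]$ when $V=\mathbb C$. Write $N=n_1^2+\cdots+n_k^2$ and $S_q^d(\ell_p^N[V])=S_q^d\big[\ell_p^N[V]\big]$.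 Then there exist a completely positive complete isometry (not necessarily onto) $$J:S_p^{n_1}\oplus_p\cdots\oplus_pS_p^{n_k}\longrightarrow S_q^d\big(\ell_p^{N}\big)$$ and a completely positive and completely contractive map $$W:S_q^d\big(\ell_p^{N}\big)\longrightarrow S_p^{n_1}\oplus_p\cdots\oplus_pS_p^{n_k}$$ with $W\circ J=\mathrm{id}$. Here complete positivity refers to the underlying C*-algebras $M_{n_1}\oplus\cdots\oplus M_{n_k}$ and $M_d(\ell_\infty^N)$. Moreover, the result holds in the vector-valued setting: for every operator space $E$, the map $$J\otimes\mathrm{id}_E:S_p^{n_1}[E]\oplus_p\cdots\oplus_pS_p^{n_k}[E]\longrightarrow S_q^d\big(\ell_p^{N}[E]\big)$$ is a complete isometry, the map $W\otimes\mathrm{id}_E$ in the opposite direction is completely contractive, and $(W\otimes\mathrm{id}_E)\circ(J\otimes\mathrm{id}_E)=\mathrm{id}$. In particular, $S_p^{n_1}[E]\oplus_p\cdots\oplus_pS_p^{n_k}[E]$ is completely isometric to a completely complemented subspace of $S_q^d(\ell_p^N[E])$, namely the range of $J\otimes\mathrm{id}_E$, which is the range of a completely contractive projection. -/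

import Mathlib

open scoped ENNReal

universe u v

namespace OpSpace

/-- A family of functions on all the spaces `M_ι[V]` of square matrices over `V`, `ι` a finite set:
the data of matrix norms. (Rows and columns may be labelled by any finite set; in an operator space
relabelling is isometric, so `ι` with `k` elements always stands for `M_k[V]`.) -/
def MatNorm (V : Type u) : Type (max u 1) :=
  ∀ (ι : Type) [Fintype ι], Matrix ι ι V → ℝ

/-! ### Complete contractions and complete isometries -/

section Maps

variable {V : Type u} [AddCommGroup V] [Module ℂ V] {W : Type v} [AddCommGroup W] [Module ℂ W]

/-- `‖T‖_cb ≤ 1`: every amplification `id ⊗ T : M_ι[V] → M_ι[W]` is a contraction. -/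
def CompletelyContractive (N : MatNorm V) (N' : MatNorm W) (T : V →ₗ[ℂ] W) : Prop :=
  ∀ (ι : Type) [Fintype ι] (x : Matrix ι ι V), N' ι (x.map T) ≤ N ι x

/-- Every amplification `id ⊗ T : M_ι[V] → M_ι[W]` is an isometry (not necessarily onto). -/
def CompleteIsometry (N : MatNorm V) (N' : MatNorm W) (T : V →ₗ[ℂ] W) : Prop :=
  ∀ (ι : Type) [Fintype ι] (x : Matrix ι ι V), N' ι (x.map T) = N ι x

/-- The completely bounded norm of `T`. -/
noncomputable def cbNorm (N : MatNorm V) (N' : MatNorm W) (T : V →ₗ[ℂ] W) : ℝ :=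
  sSup {r : ℝ | ∃ (m : ℕ) (x : Matrix (Fin m) (Fin m) V),
    N (Fin m) x ≤ 1 ∧ r = N' (Fin m) (x.map T)}

/-- `F` is the range of a completely contractive projection. -/
def CompletelyComplemented (N : MatNorm V) (F : Submodule ℂ V) : Prop :=
  ∃ P : V →ₗ[ℂ] V, CompletelyContractive N N P ∧ P ∘ₗ P = P ∧ LinearMap.range P = F

end Maps

/-! ### Scalars, concrete operator spaces, matrices over an operator space -/

open Classical in
/-- The norm of a complex matrix as an operator `ℓ₂^κ → ℓ₂^ι`. -/
noncomputable def opNorm {ι κ : Type} [Fintype ι] [Fintype κ] (A : Matrix ι κ ℂ) : ℝ :=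
  ‖(Matrix.toEuclideanLin A).toContinuousLinearMap‖

/-- The operator space `ℂ`: `M_ι[ℂ]` carries the operator norm. -/
noncomputable def scalarNorm : MatNorm ℂ := fun _ _ x => opNorm x

section Concrete

variable {H : Type u} [NormedAddCommGroup H] [InnerProductSpace ℂ H]

/-- A matrix `x` over `B(H)` as an operator on the Hilbert space `ℓ₂^ι ⊗ H = ℓ₂^ι(H)`:
`(x ξ)_i = ∑ j, x_{ij} ξ_j`. -/
noncomputable def blockOp {ι : Type} [Fintype ι] (x : Matrix ι ι (H →L[ℂ] H)) :
    PiLp 2 (fun _ : ι => H) →L[ℂ] PiLp 2 (fun _ : ι => H) :=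
  ((PiLp.continuousLinearEquiv 2 ℂ (fun _ : ι => H)).symm :
      (ι → H) →L[ℂ] PiLp 2 (fun _ : ι => H)) ∘L
    (ContinuousLinearMap.pi fun i => ∑ j, x i j ∘L ContinuousLinearMap.proj j) ∘L
    ((PiLp.continuousLinearEquiv 2 ℂ (fun _ : ι => H)) :
      PiLp 2 (fun _ : ι => H) →L[ℂ] (ι → H))

/-- The operator space structure of a subspace `E ⊆ B(H)`: `M_ι[E] ⊆ M_ι(B(H)) = B(ℓ₂^ι ⊗ H)`. -/
noncomputable def subspaceNorm (E : Submodule ℂ (H →L[ℂ] H)) : MatNorm E :=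
  fun _ _ x => ‖blockOp (x.map fun e : E => (e : H →L[ℂ] H))‖

end Concrete

/-- The operator space `M_n[V] = M_n ⊗_min V`, through `M_ι[M_n[V]] = M_{ι × n}[V]`. -/
def minNorm (n : Type) [Fintype n] {V : Type u} (N : MatNorm V) : MatNorm (n → n → V) :=
  fun ι _ x => N (ι × n) (Matrix.of fun r s => x r.1 s.1 r.2 s.2)

/-! ### The trace class and the projective tensor product with it -/

/-- For `x` in `M_ι ⊗ M_n`, the map `M_n → M_ι`, `C ↦ (⟨x_{rs}, C⟩)_{rs}`, with
`⟨B, C⟩ = tr (B Cᵗ) = ∑ B_{ab} C_{ab}`. -/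
noncomputable def pairing {n ι : Type} [Fintype n] (x : Matrix ι ι (n → n → ℂ)) :
    (n → n → ℂ) →ₗ[ℂ] (ι → ι → ℂ) where
  toFun C := fun r s => ∑ a, ∑ b, x r s a b * C a b
  map_add' C D := by
    funext r s
    simp [mul_add, Finset.sum_add_distrib]
  map_smul' c C := by
    funext r s
    simp [Finset.mul_sum, mul_left_comm]

/-- The operator space `S_1^n = (M_n)^*`: `M_ι[S_1^n] = CB(M_n, M_ι)`. -/
noncomputable def traceNorm (n : Type) [Fintype n] : MatNorm (n → n → ℂ) :=
  fun ι _ x => cbNorm (minNorm n scalarNorm) (minNorm ι scalarNorm) (pairing x)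

/-- The operator space projective tensor product `S_1^n[V] = S_1^n ⊗^ V`, on the vector space
`M_n ⊗ V = M_n(V)`: the norm of `t` in `M_ι[S_1^n ⊗^ V]` is the infimum of
`‖α‖ ‖x‖ ‖y‖ ‖β‖` over all representations `t = α (x ⊗ y) β` with `x` in `M_l[S_1^n]`,
`y` in `M_m[V]` and scalar rectangular matrices `α`, `β`. -/
noncomputable def projNorm (n : Type) [Fintype n] {V : Type u} [AddCommGroup V] [Module ℂ V]
    (N : MatNorm V) : MatNorm (n → n → V) :=
  fun ι _ t => sInf {c : ℝ | ∃ (l m : ℕ)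
    (α : Matrix ι (Fin l × Fin m) ℂ) (β : Matrix (Fin l × Fin m) ι ℂ)
    (x : Matrix (Fin l) (Fin l) (n → n → ℂ)) (y : Matrix (Fin m) (Fin m) V),
    (∀ (r s : ι) (a b : n), t r s a b =
      ∑ i, ∑ g, ∑ j, ∑ h, (α r (i, g) * x i j a b * β (j, h) s) • y g h) ∧
    c = opNorm α * traceNorm n (Fin l) x * N (Fin m) y * opNorm β}

/-! ### Complex interpolation -/

section Interpolation

variable {V : Type u} [NormedAddCommGroup V] [NormedSpace ℂ V]

/-- `f` is a bounded continuous function on the closed strip `0 ≤ Re z ≤ 1` with values in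
`M_ι[V]`, analytic in the open strip, with `‖f(it)‖₀ ≤ C` and `‖f(1+it)‖₁ ≤ C` for all real `t`. -/
def IsAdmissible (N₀ N₁ : MatNorm V) (ι : Type) [Fintype ι] (f : ℂ → ι → ι → V) (C : ℝ) : Prop :=
  DiffContOnCl ℂ f {z : ℂ | 0 < z.re ∧ z.re < 1} ∧
  (∃ B : ℝ, ∀ z : ℂ, 0 ≤ z.re → z.re ≤ 1 → ‖f z‖ ≤ B) ∧
  (∀ t : ℝ, N₀ ι (Matrix.of (f (t * Complex.I))) ≤ C) ∧
  (∀ t : ℝ, N₁ ι (Matrix.of (f (1 + t * Complex.I))) ≤ C)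

/-- The complex interpolation space `(V₀, V₁)_θ` with the operator space structure
`M_ι[(V₀, V₁)_θ] = (M_ι[V₀], M_ι[V₁])_θ`, for two operator space structures on one vector space
`V` that are, level by level, equivalent to the given norm of `V` (applied entrywise); this norm is
used only for its topology and bounded sets, which are those of `V₀ + V₁`.
For `θ = 0` and `θ = 1` this gives back `V₀` and `V₁`. -/
noncomputable def interp (θ : ℝ) (N₀ N₁ : MatNorm V) : MatNorm V :=
  fun ι _ x => sInf {C : ℝ | ∃ f : ℂ → ι → ι → V,
    IsAdmissible N₀ N₁ ι f C ∧ Matrix.of (f (θ : ℂ)) = x}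

/-- `S_q^n[V] = (M_n[V], S_1^n[V])_{1/q}`. -/
noncomputable def schattenNorm (q : ℝ≥0∞) (n : Type) [Fintype n] (N : MatNorm V) :
    MatNorm (n → n → V) :=
  interp q⁻¹.toReal (minNorm n N) (projNorm n N)

end Interpolation

/-! ### Direct sums -/

section Sums

variable {κ : Type} [Fintype κ] {V : κ → Type u}

/-- The `ℓ_∞`-direct sum of operator spaces. -/
noncomputable def sumInftyNorm (N : ∀ i, MatNorm (V i)) : MatNorm (∀ i, V i) :=
  fun ι _ x => ⨆ i, N i ι (Matrix.of fun r s => x r s i)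

/-- The `ℓ_1`-direct sum of operator spaces, that is, their coproduct: the norm of `x = ⊕ x_i` in
`M_ι[⊕_1 V_i]` is the supremum of `‖∑ (id ⊗ u_i)(x_i)‖` over all `m` and all families of complete
contractions `u_i : V_i → M_m`. -/
noncomputable def sumOneNorm [∀ i, AddCommGroup (V i)] [∀ i, Module ℂ (V i)]
    (N : ∀ i, MatNorm (V i)) : MatNorm (∀ i, V i) :=
  fun ι _ x => sSup {c : ℝ | ∃ (m : ℕ) (φ : ∀ i, V i →ₗ[ℂ] (Fin m → Fin m → ℂ)),
    (∀ i, CompletelyContractive (N i) (minNorm (Fin m) scalarNorm) (φ i)) ∧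
    c = minNorm (Fin m) scalarNorm ι (Matrix.of fun r s => ∑ i, φ i (x r s i))}

/-- The `p`-direct sum of the interpolation spaces `(V_i⁰, V_i¹)_{1/p}`, by interpolation:
`(⊕_∞ V_i⁰, ⊕_1 V_i¹)_{1/p}`. -/
noncomputable def sumNorm (p : ℝ≥0∞) [∀ i, NormedAddCommGroup (V i)] [∀ i, NormedSpace ℂ (V i)]
    (N₀ N₁ : ∀ i, MatNorm (V i)) : MatNorm (∀ i, V i) :=
  interp p⁻¹.toReal (sumInftyNorm N₀) (sumOneNorm N₁)

end Sums

section Spaces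

variable {V : Type u} [NormedAddCommGroup V] [NormedSpace ℂ V]

/-- The vector space `M_{n_1}(V) ⊕ ⋯ ⊕ M_{n_k}(V)`. -/
abbrev BlockSum {k : ℕ} (n : Fin k → ℕ) (V : Type u) : Type u :=
  ∀ i : Fin k, Fin (n i) → Fin (n i) → V

/-- `S_p^{n_1}[V] ⊕_p ⋯ ⊕_p S_p^{n_k}[V]
= (M_{n_1}[V] ⊕_∞ ⋯ ⊕_∞ M_{n_k}[V], S_1^{n_1}[V] ⊕_1 ⋯ ⊕_1 S_1^{n_k}[V])_{1/p}`. -/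
noncomputable def schattenSumNorm (p : ℝ≥0∞) {k : ℕ} (n : Fin k → ℕ) (N : MatNorm V) :
    MatNorm (BlockSum n V) :=
  sumNorm p (fun i => minNorm (Fin (n i)) N) (fun i => projNorm (Fin (n i)) N)

/-- `ℓ_p^m[V] = (ℓ_∞^m[V], ℓ_1^m[V])_{1/p}`. -/
noncomputable def ellNorm (p : ℝ≥0∞) (m : ℕ) (N : MatNorm V) : MatNorm (Fin m → V) :=
  sumNorm p (fun _ => N) (fun _ => N)

/-- The vector space `M_d(ℓ^m(V))`. -/
abbrev MatEll (d m : ℕ) (V : Type u) : Type u := Fin d → Fin d → Fin m → V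

/-- `S_q^d(ℓ_p^m[V])`. -/
noncomputable def schattenEllNorm (q p : ℝ≥0∞) (d m : ℕ) (N : MatNorm V) :
    MatNorm (MatEll d m V) :=
  schattenNorm q (Fin d) (ellNorm p m N)

end Spaces

/-! ### Complete positivity -/

/-- A family of subsets of the spaces `M_ι[V]`: the data of matrix cones. -/
def MatCone (V : Type u) : Type (max u 1) :=
  ∀ (ι : Type) [Fintype ι], Set (Matrix ι ι V)

/-- Every amplification `id ⊗ T : M_ι[V] → M_ι[W]` preserves positivity. -/
def CompletelyPositive {V W : Type} [AddCommGroup V] [Module ℂ V] [AddCommGroup W] [Module ℂ W]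
    (P : MatCone V) (Q : MatCone W) (T : V →ₗ[ℂ] W) : Prop :=
  ∀ (ι : Type) [Fintype ι], ∀ x ∈ P ι, x.map T ∈ Q ι

open scoped ComplexOrder in
/-- The positive elements of the C*-algebras `M_ι(M_{n_1} ⊕ ⋯ ⊕ M_{n_k}) = ⊕_i M_{ι × n_i}`. -/
def blockSumCone {k : ℕ} (n : Fin k → ℕ) : MatCone (BlockSum n ℂ) :=
  fun ι _ => {x | ∀ i, Matrix.PosSemidef
    (Matrix.of fun r s : ι × Fin (n i) => x r.1 s.1 i r.2 s.2)}

open scoped ComplexOrder in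
/-- The positive elements of the C*-algebras `M_ι(M_d(ℓ_∞^m)) = ⊕_{j ≤ m} M_{ι × d}`. -/
def matEllCone (d m : ℕ) : MatCone (MatEll d m ℂ) :=
  fun ι _ => {y | ∀ j, Matrix.PosSemidef
    (Matrix.of fun r s : ι × Fin d => y r.1 s.1 r.2 s.2 j)}

end OpSpace

open OpSpace

set_option linter.unusedSectionVars false

/-! The Weyl operators are `n^2` unitaries in `M_n`, mutually orthogonal for the Hilbert–Schmidt
inner product and of Hilbert–Schmidt norm `√n`. Since `n_i` divides `d`, `ℂ^d` splits into `d / n_i`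
copies of `ℂ^{n_i}`. Composing the Weyl operators `U_s` with the inclusions of the copies gives
Kraus operators `A_{sκ}` (`exists_isKrausBasis`): for fixed `s` they are isometries with orthogonal
ranges, and as vectors they are all orthogonal of norm `√n_i`. Up to weights, `J` sends `x` to the
family `∑_κ A_{sκ} x_i A_{sκ}^*` indexed by `(i, s)`, and `W` sends `y` to `∑_{s,κ} A_{sκ}^* y_{i,s}
A_{sκ}`. Both are completely positive. With weights `n_i^{-1/p} d^{-1/q}` and `n_i^{1/p-1}
d^{1/q-1}` the composition `W ∘ J` multiplies `x_i` by `n_i^{-1} d^{-1} · n_i^2 · (d / n_i) = 1`.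
Hence it suffices that `J` and `W` are completely contractive with coefficients in any operator
space: `J` is then isometric, and `J ∘ W` is the projection onto its range.

The index `p` is handled by interpolating between four endpoint estimates. Into `M_d[ℓ_∞]` the map
`J` needs weight `1`, because the `A_{sκ}` with fixed `s` form a row isometry
(`krausIn_sumInfty_le`). Into `M_d[ℓ_1]` it needs weight `1 / n_i`, because orthogonality bounds
`∑_s Y_s ⊗ |A_s⟩⟨A_s|` by `n_i max ‖Y_s‖` (`krausIn_sumOne_le`). For `W` on `S_1^d[ℓ_∞]` and
`S_1^d[ℓ_1]` the same two computations occur in the opposite order (`krausOut_sumInfty_le`,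
`krausOut_sumOne_le`). The powers `n_i^{-z}` and `n_i^{z-1}` have exactly these sizes on the two
edges of the strip.

The index `q` costs only one comparison, that the norm of `S_1^d[V]` is at most `d` times that of
`M_d[V]` (`projNorm_le_minNorm`). It lets `d^{-z}` carry the estimate for `J` from `M_d` to `S_q^d`,
and `d^{z-1}`, with the three lines theorem, carry the estimate for `W` from `S_1^d` to `S_q^d`. -/

namespace OpSpace

/-! ### Operator norms of scalar matrices -/

section OperatorNorm

variable {ι κ l ι' κ' : Type} [Fintype ι] [Fintype κ] [Fintype l] [Fintype ι'] [Fintype κ']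

theorem opNorm_nonneg (A : Matrix ι κ ℂ) : 0 ≤ opNorm A := norm_nonneg _

theorem inner_toEuclideanLin [DecidableEq κ] (A : Matrix ι κ ℂ) (w : EuclideanSpace ℂ ι)
    (v : EuclideanSpace ℂ κ) :
    inner ℂ w (Matrix.toEuclideanLin A v) = ∑ i, ∑ j, star (w i) * A i j * v j := by
  simp only [PiLp.inner_apply, Matrix.toLpLin_apply, Matrix.mulVec, dotProduct]
  refine Finset.sum_congr rfl fun i _ => ?_
  simp only [RCLike.inner_apply, Finset.sum_mul]
  refine Finset.sum_congr rfl fun j _ => ?_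
  simp only [starRingEnd_apply]; ring

theorem norm_form_le (A : Matrix ι κ ℂ) (w : EuclideanSpace ℂ ι) (v : EuclideanSpace ℂ κ) :
    ‖∑ i, ∑ j, star (w i) * A i j * v j‖ ≤ opNorm A * ‖w‖ * ‖v‖ := by
  classical
  rw [← inner_toEuclideanLin]
  refine (norm_inner_le_norm _ _).trans ?_
  have := (Matrix.toEuclideanLin A).toContinuousLinearMap.le_opNorm v
  have h2 : ‖(Matrix.toEuclideanLin A).toContinuousLinearMap‖ = opNorm A := by
    unfold opNorm; congr!
  rw [h2] at this
  calc ‖w‖ * ‖Matrix.toEuclideanLin A v‖ ≤ ‖w‖ * (opNorm A * ‖v‖) := by gcongr; exact this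
    _ = _ := by ring

theorem opNorm_le_of_form {A : Matrix ι κ ℂ} {C : ℝ} (hC : 0 ≤ C)
    (h : ∀ (w : EuclideanSpace ℂ ι) (v : EuclideanSpace ℂ κ),
      ‖∑ i, ∑ j, star (w i) * A i j * v j‖ ≤ C * ‖w‖ * ‖v‖) : opNorm A ≤ C := by
  classical
  have h2 : ‖(Matrix.toEuclideanLin A).toContinuousLinearMap‖ = opNorm A := by
    unfold opNorm; congr!
  rw [← h2]
  refine ContinuousLinearMap.opNorm_le_bound _ hC fun v => ?_
  -- Testing against `w = A v` turns the form into `‖A v‖ ^ 2`; one factor is cancelled below unless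
  -- it is zero.
  have := h (Matrix.toEuclideanLin A v) v
  rw [← inner_toEuclideanLin, inner_self_eq_norm_sq_to_K] at this
  simp only [norm_pow, RCLike.norm_ofReal, abs_norm, LinearMap.coe_toContinuousLinearMap'] at this ⊢
  rcases (norm_nonneg (Matrix.toEuclideanLin A v)).eq_or_lt with h0 | h0
  · rw [← h0]; positivity
  · nlinarith

theorem opNorm_mul_le (A : Matrix ι κ ℂ) (B : Matrix κ l ℂ) :
    opNorm (A * B) ≤ opNorm A * opNorm B := by
  classical
  have e : ∀ {a b : Type} [Fintype a] [Fintype b] [DecidableEq b] (M : Matrix a b ℂ),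
      opNorm M = ‖(Matrix.toEuclideanLin M).toContinuousLinearMap‖ := by
    intros; unfold opNorm; congr!
  rw [e, e A, e B]
  refine ContinuousLinearMap.opNorm_le_bound _ (by positivity) fun v => ?_
  have : (Matrix.toEuclideanLin (A * B)).toContinuousLinearMap v =
      (Matrix.toEuclideanLin A).toContinuousLinearMap
        ((Matrix.toEuclideanLin B).toContinuousLinearMap v) := by
    simp [Matrix.toLpLin_apply, Matrix.mulVec_mulVec]
  rw [this, mul_assoc]
  refine (ContinuousLinearMap.le_opNorm _ _).trans ?_
  gcongr
  exact ContinuousLinearMap.le_opNorm _ _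

theorem opNorm_conjTranspose_le (A : Matrix ι κ ℂ) : opNorm A.conjTranspose ≤ opNorm A := by
  refine opNorm_le_of_form (opNorm_nonneg A) fun w v => ?_
  have := norm_form_le A v w
  rw [← norm_star, Finset.sum_comm, star_sum]
  simp only [star_sum, star_mul', star_star, Matrix.conjTranspose_apply]
  calc _ = _ := by
        congr 1
        exact Finset.sum_congr rfl fun i _ => Finset.sum_congr rfl fun j _ => by ring
    _ ≤ _ := this
    _ = _ := by ring

theorem opNorm_conjTranspose (A : Matrix ι κ ℂ) : opNorm A.conjTranspose = opNorm A :=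
  le_antisymm (opNorm_conjTranspose_le A) (by simpa using opNorm_conjTranspose_le A.conjTranspose)

open scoped Matrix.Norms.L2Operator in
-- The C*-identity. It serves both families of Kraus operators: `C = 1` for row isometries, `C = n`
-- for orthogonal vectors of norm `√n`.
theorem opNorm_le_sqrt [DecidableEq κ] {A : Matrix ι κ ℂ} {C : ℝ} (hC : 0 ≤ C)
    (h : A.conjTranspose * A = (C : ℂ) • (1 : Matrix κ κ ℂ)) : opNorm A ≤ Real.sqrt C := by
  have e : opNorm A = ‖A‖ := by
    rw [Matrix.l2_opNorm_def]; unfold opNorm; congr!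
  have h1 := Matrix.l2_opNorm_conjTranspose_mul_self A
  have h2 : ‖(1 : Matrix κ κ ℂ)‖ ≤ 1 := by
    rw [← Matrix.diagonal_one, Matrix.l2_opNorm_diagonal]
    exact (pi_norm_le_iff_of_nonneg zero_le_one).2 fun _ => by simp
  rw [h, norm_smul, Complex.norm_real, Real.norm_of_nonneg hC] at h1
  rw [e]
  exact Real.le_sqrt_of_sq_le (by nlinarith)

theorem opNorm_submatrix (A : Matrix ι κ ℂ) (e : ι' ≃ ι) (f : κ' ≃ κ) :
    opNorm (A.submatrix e f) = opNorm A := by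
  have key : ∀ {ι κ ι' κ' : Type} [Fintype ι] [Fintype κ] [Fintype ι'] [Fintype κ']
      (A : Matrix ι κ ℂ) (e : ι' ≃ ι) (f : κ' ≃ κ), opNorm (A.submatrix e f) ≤ opNorm A := by
    intro ι κ ι' κ' _ _ _ _ A e f
    refine opNorm_le_of_form (opNorm_nonneg A) fun w v => ?_
    have := norm_form_le A (LinearIsometryEquiv.piLpCongrLeft 2 ℂ ℂ e w)
      (LinearIsometryEquiv.piLpCongrLeft 2 ℂ ℂ f v)
    rw [LinearIsometryEquiv.norm_map, LinearIsometryEquiv.norm_map] at this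
    refine le_trans (le_of_eq ?_) this
    congr 1
    rw [← Equiv.sum_comp e]
    refine Finset.sum_congr rfl fun i _ => ?_
    rw [← Equiv.sum_comp f]
    simp [LinearIsometryEquiv.piLpCongrLeft_apply, Equiv.piCongrLeft']
  refine le_antisymm (key A e f) ?_
  simpa using key (A.submatrix e f) e.symm f.symm

theorem opNorm_add_le (A B : Matrix ι κ ℂ) : opNorm (A + B) ≤ opNorm A + opNorm B := by
  unfold opNorm
  rw [map_add, map_add]
  exact norm_add_le _ _

theorem opNorm_smul (c : ℂ) (A : Matrix ι κ ℂ) : opNorm (c • A) = ‖c‖ * opNorm A := by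
  unfold opNorm
  rw [map_smul, map_smul, norm_smul]

theorem opNorm_zero : opNorm (0 : Matrix ι κ ℂ) = 0 := by
  unfold opNorm
  rw [map_zero, map_zero, norm_zero]

theorem opNorm_sum_le {σ : Type*} (s : Finset σ) (A : σ → Matrix ι κ ℂ) :
    opNorm (∑ i ∈ s, A i) ≤ ∑ i ∈ s, opNorm (A i) :=
  Finset.le_sum_of_subadditive _ opNorm_zero.le opNorm_add_le _ _

theorem sum_norm_slice_le {β σ : Type} [Fintype β] [Fintype σ] (w : EuclideanSpace ℂ (β × σ)) :
    ∑ s, ‖(WithLp.toLp 2 (fun b => w (b, s)) : EuclideanSpace ℂ β)‖ ^ 2 = ‖w‖ ^ 2 := by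
  simp only [EuclideanSpace.norm_sq_eq]
  rw [Fintype.sum_prod_type_right]

/-- A block diagonal matrix is bounded by the bound of its blocks. -/
theorem opNorm_blockDiagonal_le {β β' σ : Type} [Fintype β] [Fintype β'] [Fintype σ]
    [DecidableEq σ] {Y : σ → Matrix β β' ℂ} {C : ℝ} (hC : 0 ≤ C) (hY : ∀ s, opNorm (Y s) ≤ C) :
    opNorm (Matrix.blockDiagonal Y) ≤ C := by
  refine opNorm_le_of_form hC fun w v => ?_
  set w' : σ → EuclideanSpace ℂ β := fun s => WithLp.toLp 2 (fun b => w (b, s)) with hw'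
  set v' : σ → EuclideanSpace ℂ β' := fun s => WithLp.toLp 2 (fun b => v (b, s)) with hv'
  have h1 : ∑ i, ∑ j, star (w i) * Matrix.blockDiagonal Y i j * v j =
      ∑ s, ∑ b, ∑ b', star (w' s b) * Y s b b' * v' s b' := by
    rw [Fintype.sum_prod_type_right]
    refine Finset.sum_congr rfl fun s _ => Finset.sum_congr rfl fun b _ => ?_
    rw [Fintype.sum_prod_type]
    refine Finset.sum_congr rfl fun b' _ => ?_
    simp [Matrix.blockDiagonal_apply, w', v']
  rw [h1]
  calc _ ≤ ∑ s, ‖∑ b, ∑ b', star (w' s b) * Y s b b' * v' s b'‖ := norm_sum_le _ _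
    _ ≤ ∑ s, C * (‖w' s‖ * ‖v' s‖) := by
        refine Finset.sum_le_sum fun s _ => (norm_form_le _ _ _).trans ?_
        rw [mul_assoc]
        gcongr
        exact hY s
    _ = C * ∑ s, ‖w' s‖ * ‖v' s‖ := by rw [Finset.mul_sum]
    _ ≤ C * (Real.sqrt (∑ s, ‖w' s‖ ^ 2) * Real.sqrt (∑ s, ‖v' s‖ ^ 2)) := by
        gcongr
        exact Real.sum_mul_le_sqrt_mul_sqrt _ _ _
    _ = C * ‖w‖ * ‖v‖ := by
        rw [sum_norm_slice_le, sum_norm_slice_le, Real.sqrt_sq (norm_nonneg _),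
          Real.sqrt_sq (norm_nonneg _), mul_assoc]

end OperatorNorm
-- Norms of Kraus-type sums
section Sandwich

variable {α α' β β' σ τ ν ν' ρ ρ' n ι : Type} [Fintype α] [Fintype α'] [Fintype β] [Fintype β']
  [Fintype σ] [Fintype τ] [Fintype ν] [Fintype ν'] [Fintype ρ] [Fintype ρ'] [Fintype n] [Fintype ι]

/-- The sum is `L * blockDiagonal Y * R`, so the middle factor costs only the largest block. All
bounds on Kraus sums reduce to this one. -/
theorem opNorm_sandwich_le (L : Matrix α (β × σ) ℂ) (R : Matrix (β' × σ) α' ℂ)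
    {Y : σ → Matrix β β' ℂ} {C : ℝ} (hC : 0 ≤ C) (hY : ∀ s, opNorm (Y s) ≤ C) :
    opNorm (Matrix.of fun p q => ∑ s, ∑ b, ∑ b', L p (b, s) * Y s b b' * R (b', s) q) ≤
      opNorm L * C * opNorm R := by
  classical
  have h : (Matrix.of fun p q => ∑ s, ∑ b, ∑ b', L p (b, s) * Y s b b' * R (b', s) q) =
      L * Matrix.blockDiagonal Y * R := by
    ext p q
    simp only [Matrix.of_apply, Matrix.mul_apply, Fintype.sum_prod_type_right,
      Matrix.blockDiagonal_apply, Finset.sum_mul]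
    refine Finset.sum_congr rfl fun s _ => ?_
    rw [Finset.sum_comm]
    refine Finset.sum_congr rfl fun b' _ => ?_
    rw [Finset.sum_comm]
    refine Finset.sum_congr rfl fun b _ => ?_
    simp
  rw [h]
  refine (opNorm_mul_le _ _).trans ?_
  refine mul_le_mul_of_nonneg_right ?_ (opNorm_nonneg _)
  refine (opNorm_mul_le _ _).trans ?_
  exact mul_le_mul_of_nonneg_left (opNorm_blockDiagonal_le hC hY) (opNorm_nonneg _)

open Classical in
/-- The matrix `1 ⊗ L`. -/
noncomputable def idTensor (ρ : Type) (L : Matrix ν τ ℂ) : Matrix (ρ × ν) (ρ × τ) ℂ :=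
  Matrix.of fun p q => if p.1 = q.1 then L p.2 q.2 else 0

theorem opNorm_idTensor_le (L : Matrix ν τ ℂ) : opNorm (idTensor ρ L) ≤ opNorm L := by
  classical
  have h : idTensor ρ L = (Matrix.blockDiagonal fun _ : ρ => L).submatrix
      (Equiv.prodComm ρ ν) (Equiv.prodComm ρ τ) := by
    ext p q
    simp [idTensor, Matrix.blockDiagonal_apply]
  rw [h, opNorm_submatrix]
  exact opNorm_blockDiagonal_le (opNorm_nonneg _) fun _ => le_rfl

/-- The norm of `∑_s Y_s ⊗ L_s R_s`. -/
theorem opNorm_sum_rankOne_le (L : Matrix ν σ ℂ) (R : Matrix σ ν' ℂ) {Y : σ → Matrix ρ ρ' ℂ}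
    {C : ℝ} (hC : 0 ≤ C) (hY : ∀ s, opNorm (Y s) ≤ C) :
    opNorm (Matrix.of fun (p : ρ × ν) (q : ρ' × ν') =>
      ∑ s, L p.2 s * Y s p.1 q.1 * R s q.2) ≤ opNorm L * C * opNorm R := by
  classical
  have h := opNorm_sandwich_le (idTensor ρ L) (idTensor ρ' R) hC hY
  refine le_trans (le_of_eq ?_) (h.trans ?_)
  · congr 1
    ext p q
    simp [idTensor]
  · have h1 := opNorm_nonneg (idTensor ρ' R)
    have h2 := opNorm_nonneg L
    gcongr
    · exact opNorm_idTensor_le L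
    · exact opNorm_idTensor_le R

/-- The norm of `∑_c (1 ⊗ L_c) x (1 ⊗ R_c)`. -/
theorem opNorm_kraus_le (L : Matrix ν (n × σ) ℂ) (R : Matrix (n × σ) ν' ℂ)
    (x : Matrix (ρ × n) (ρ × n) ℂ) :
    opNorm (Matrix.of fun (p : ρ × ν) (q : ρ × ν') =>
      ∑ c, ∑ b, ∑ b', L p.2 (b, c) * x (p.1, b) (q.1, b') * R (b', c) q.2) ≤
      opNorm L * opNorm x * opNorm R := by
  classical
  have h := opNorm_sandwich_le ((idTensor ρ L).submatrix id (Equiv.prodAssoc ρ n σ))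
    ((idTensor ρ R).submatrix (Equiv.prodAssoc ρ n σ) id) (Y := fun _ : σ => x)
    (opNorm_nonneg x) (fun _ => le_rfl)
  refine le_trans (le_of_eq ?_) (h.trans ?_)
  · congr 1
    ext p q
    simp [idTensor, Fintype.sum_prod_type]
  · have h1 := opNorm_submatrix (idTensor ρ L) (Equiv.refl _) (Equiv.prodAssoc ρ n σ)
    have h2 := opNorm_submatrix (idTensor ρ R) (Equiv.prodAssoc ρ n σ) (Equiv.refl _)
    rw [Equiv.coe_refl] at h1 h2
    rw [h1, h2]
    have h3 := opNorm_nonneg x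
    have h4 := opNorm_nonneg (idTensor ρ R)
    have h5 := opNorm_nonneg L
    gcongr
    · exact opNorm_idTensor_le L
    · exact opNorm_idTensor_le R

end Sandwich

/-! ### Duality between the trace class and matrices -/

section Trace

variable {n ι ρ μ σ : Type} [Fintype n] [Fintype ι] [Fintype ρ] [Fintype μ] [Fintype σ]

/-- The matrix `(id ⊗ ⟨x, ·⟩)(D)` for `x` in `M_ι[S_1^n]` and `D` in `M_ρ ⊗ M_n`. -/
def slice (x : Matrix ι ι (n → n → ℂ)) (D : Matrix (ρ × n) (ρ × n) ℂ) :
    Matrix (ρ × ι) (ρ × ι) ℂ :=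
  Matrix.of fun p q => ∑ a, ∑ b, x p.2 q.2 a b * D (p.1, a) (q.1, b)

/-- A crude bound, uniform in the size of `D`. It makes the supremum defining `traceNorm` one of a
bounded set, hence not the default value `0`. -/
theorem exists_slice_bound (x : Matrix ι ι (n → n → ℂ)) :
    ∃ K : ℝ, ∀ (ρ : Type) [Fintype ρ] (D : Matrix (ρ × n) (ρ × n) ℂ),
      opNorm (slice x D) ≤ K * opNorm D := by
  classical
  -- One Kraus term for each pair of positions `(a, b)` and `(r, s)`: matrix units move the entry of
  -- `D` at `(a, b)` to `(r, s)`, and `L` carries the coefficient.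
  let L : Matrix ι (n × ((n × n) × (ι × ι))) ℂ := Matrix.of fun r c =>
    if c.1 = c.2.1.1 then (if r = c.2.2.1 then x c.2.2.1 c.2.2.2 c.2.1.1 c.2.1.2 else 0) else 0
  let R : Matrix (n × ((n × n) × (ι × ι))) ι ℂ := Matrix.of fun c s =>
    if c.1 = c.2.1.2 then (if s = c.2.2.2 then 1 else 0) else 0
  refine ⟨opNorm L * opNorm R, fun ρ _ D => ?_⟩
  refine le_trans (le_of_eq ?_) ((opNorm_kraus_le L R D).trans (le_of_eq (by ring)))
  congr 1
  ext p q
  simp [slice, L, R, Fintype.sum_prod_type]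

theorem opNorm_eq_zero {ι κ : Type} [Fintype ι] [Fintype κ] {A : Matrix ι κ ℂ}
    (h : opNorm A = 0) : A = 0 := by
  unfold opNorm at h
  rw [norm_eq_zero] at h
  simpa using h

theorem traceNorm_nonneg (x : Matrix ι ι (n → n → ℂ)) : 0 ≤ traceNorm n ι x := by
  refine Real.sSup_nonneg ?_
  rintro r ⟨m, y, -, rfl⟩
  exact opNorm_nonneg _

/-- Pairing with `x` is a map `M_n → M_ι` of completely bounded norm `traceNorm n ι x`; the
definition tests it only on unit balls of matrices indexed by some `Fin m`, so relabelling and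
scaling give the general case. -/
theorem opNorm_slice_le (x : Matrix ι ι (n → n → ℂ)) (D : Matrix (ρ × n) (ρ × n) ℂ) :
    opNorm (slice x D) ≤ traceNorm n ι x * opNorm D := by
  obtain ⟨K, hK⟩ := exists_slice_bound x
  have hbdd : BddAbove {r : ℝ | ∃ (m : ℕ) (y : Matrix (Fin m) (Fin m) (n → n → ℂ)),
      minNorm n scalarNorm (Fin m) y ≤ 1 ∧
        r = minNorm ι scalarNorm (Fin m) (y.map (pairing x))} := by
    refine ⟨max K 0, ?_⟩
    rintro r ⟨m, y, hy, rfl⟩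
    have h := hK (Fin m) (Matrix.of fun r s => y r.1 s.1 r.2 s.2)
    calc _ ≤ _ := h
      _ ≤ max K 0 * 1 := by
        gcongr
        · exact opNorm_nonneg _
        · exact le_max_left _ _
        · exact hy
      _ = _ := mul_one _
  have key : ∀ (m : ℕ) (D : Matrix (Fin m × n) (Fin m × n) ℂ), opNorm D ≤ 1 →
      opNorm (slice x D) ≤ traceNorm n ι x := by
    intro m D hD
    exact le_csSup hbdd ⟨m, Matrix.of fun g h a b => D (g, a) (h, b), hD, rfl⟩
  let e := Fintype.equivFin ρ
  set D' : Matrix (Fin (Fintype.card ρ) × n) (Fin (Fintype.card ρ) × n) ℂ :=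
    D.submatrix (e.symm.prodCongr (Equiv.refl n)) (e.symm.prodCongr (Equiv.refl n)) with hD'
  have h1 : opNorm D' = opNorm D := opNorm_submatrix _ _ _
  have h2 : opNorm (slice x D') = opNorm (slice x D) := by
    rw [← opNorm_submatrix (slice x D) (e.symm.prodCongr (Equiv.refl ι))
      (e.symm.prodCongr (Equiv.refl ι))]
    rfl
  rw [← h1, ← h2]
  rcases (opNorm_nonneg D').eq_or_lt with h0 | h0
  · rw [← h0, opNorm_eq_zero h0.symm]
    have : slice x (0 : Matrix (Fin (Fintype.card ρ) × n) (Fin (Fintype.card ρ) × n) ℂ) = 0 := by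
      ext; simp [slice]
    rw [this, opNorm_zero, mul_zero]
  · have h3 := key _ (((opNorm D')⁻¹ : ℂ) • D') (by
      rw [opNorm_smul, norm_inv, Complex.norm_real, Real.norm_of_nonneg h0.le,
        inv_mul_cancel₀ h0.ne'])
    have h4 : slice x (((opNorm D')⁻¹ : ℂ) • D') = ((opNorm D')⁻¹ : ℂ) • slice x D' := by
      ext p q
      simp only [slice, Matrix.of_apply, Matrix.smul_apply, smul_eq_mul, Finset.mul_sum]
      exact Finset.sum_congr rfl fun _ _ => Finset.sum_congr rfl fun _ _ => by ring
    rw [h4, opNorm_smul, norm_inv, Complex.norm_real, Real.norm_of_nonneg h0.le,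
      inv_mul_le_iff₀ h0] at h3
    linarith

/-- The element of `M_n[S_1^n]` that stands for the identity map of `M_n`. -/
def unitElement (n : Type) [DecidableEq n] : Matrix n n (n → n → ℂ) :=
  Matrix.of fun i j a b => if i = a then (if j = b then 1 else 0) else 0

/-- Pairing with this element is the identity map of `M_n`, which is completely contractive. -/
theorem traceNorm_unitElement_le (n : Type) [Fintype n] [DecidableEq n] :
    traceNorm n n (unitElement n) ≤ 1 := by
  refine Real.sSup_le ?_ zero_le_one
  rintro r ⟨m, y, hy, rfl⟩
  have : y.map (pairing (unitElement n)) = y := by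
    ext g h a b
    simp [pairing, unitElement]
  rw [this]
  exact hy

end Trace
-- Matrix norms determined by maps into matrix algebras
section Matricial

/-- The matrix `(id ⊗ u)(x)` over `ℂ` for a map `u : V → M_ρ` and `x` in `M_ι[V]`. -/
def ampl {V : Type u} [AddCommGroup V] [Module ℂ V] {ρ ι : Type} (u : V →ₗ[ℂ] (ρ → ρ → ℂ))
    (x : Matrix ι ι V) : Matrix (ι × ρ) (ι × ρ) ℂ :=
  Matrix.of fun p q => u (x p.1 q.1) p.2 q.2

/-- The map `u : V → M_ρ` is completely contractive. -/
def CCMat {V : Type u} [AddCommGroup V] [Module ℂ V] {ρ : Type} [Fintype ρ] (N : MatNorm V)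
    (u : V →ₗ[ℂ] (ρ → ρ → ℂ)) : Prop :=
  CompletelyContractive N (minNorm ρ scalarNorm) u

theorem CCMat.opNorm_ampl_le {V : Type u} [AddCommGroup V] [Module ℂ V] {ρ ι : Type} [Fintype ρ]
    [Fintype ι] {N : MatNorm V} {u : V →ₗ[ℂ] (ρ → ρ → ℂ)} (h : CCMat N u) (x : Matrix ι ι V) :
    opNorm (ampl u x) ≤ N ι x := h ι x

theorem ccMat_of_forall {V : Type u} [AddCommGroup V] [Module ℂ V] {ρ : Type} [Fintype ρ]
    {N : MatNorm V} {u : V →ₗ[ℂ] (ρ → ρ → ℂ)}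
    (h : ∀ (ι : Type) [Fintype ι] (x : Matrix ι ι V), opNorm (ampl u x) ≤ N ι x) :
    CCMat N u := fun ι _ x => h ι x

/-- Relabelling of rows and columns as a linear map `M_ρ → M_ρ'`. -/
def relabel {ρ ρ' : Type} (e : ρ' ≃ ρ) : (ρ → ρ → ℂ) →ₗ[ℂ] (ρ' → ρ' → ℂ) where
  toFun x := fun a b => x (e a) (e b)
  map_add' _ _ := rfl
  map_smul' _ _ := rfl

theorem opNorm_ampl_relabel {V : Type u} [AddCommGroup V] [Module ℂ V] {ρ ρ' ι : Type} [Fintype ρ]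
    [Fintype ρ'] [Fintype ι] (e : ρ' ≃ ρ) (u : V →ₗ[ℂ] (ρ → ρ → ℂ)) (x : Matrix ι ι V) :
    opNorm (ampl (relabel e ∘ₗ u) x) = opNorm (ampl u x) := by
  rw [← opNorm_submatrix (ampl u x) ((Equiv.refl ι).prodCongr e) ((Equiv.refl ι).prodCongr e)]
  rfl

theorem CCMat.relabel {V : Type u} [AddCommGroup V] [Module ℂ V] {ρ ρ' : Type} [Fintype ρ]
    [Fintype ρ'] {N : MatNorm V} {u : V →ₗ[ℂ] (ρ → ρ → ℂ)} (h : CCMat N u) (e : ρ' ≃ ρ) :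
    CCMat N (relabel e ∘ₗ u) := by
  refine ccMat_of_forall fun ι _ x => ?_
  rw [opNorm_ampl_relabel]
  exact h.opNorm_ampl_le x

variable {V : Type u} [NormedAddCommGroup V] [NormedSpace ℂ V]

/-- Matrix norms that are determined by the completely contractive maps into matrix algebras and
are dominated by the entries. -/
structure IsMatricial (N : MatNorm V) : Prop where
  nonneg : ∀ (ι : Type) [Fintype ι] (x : Matrix ι ι V), 0 ≤ N ι x
  le_of_forall : ∀ (ι : Type) [Fintype ι] (x : Matrix ι ι V) (C : ℝ), 0 ≤ C →
    (∀ (m : ℕ) (u : V →ₗ[ℂ] (Fin m → Fin m → ℂ)), CCMat N u → opNorm (ampl u x) ≤ C) → N ι x ≤ C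
  le_sum : ∀ (ι : Type) [Fintype ι] (x : Matrix ι ι V), N ι x ≤ ∑ r, ∑ s, ‖x r s‖

/-- Relabelling rows and columns does not change the matrix norms. -/
def IsRelabelInvariant {V : Type u} (N : MatNorm V) : Prop :=
  ∀ (ι ι' : Type) [Fintype ι] [Fintype ι'] (e : ι' ≃ ι) (x : Matrix ι ι V),
    N ι' (x.submatrix e e) = N ι x

theorem isRelabelInvariant_of_le {V : Type u} {N : MatNorm V}
    (h : ∀ (ι ι' : Type) [Fintype ι] [Fintype ι'] (e : ι' ≃ ι) (x : Matrix ι ι V),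
      N ι' (x.submatrix e e) ≤ N ι x) : IsRelabelInvariant N := by
  intro ι ι' _ _ e x
  refine le_antisymm (h ι ι' e x) ?_
  simpa using h ι' ι e.symm (x.submatrix e e)

theorem opNorm_ampl_submatrix {V : Type u} [AddCommGroup V] [Module ℂ V] {ρ ι ι' : Type}
    [Fintype ρ] [Fintype ι] [Fintype ι'] (u : V →ₗ[ℂ] (ρ → ρ → ℂ)) (e : ι' ≃ ι)
    (x : Matrix ι ι V) : opNorm (ampl u (x.submatrix e e)) = opNorm (ampl u x) := by
  rw [← opNorm_submatrix (ampl u x) (e.prodCongr (Equiv.refl ρ)) (e.prodCongr (Equiv.refl ρ))]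
  rfl

/-- A family of matrix norms each of which is a seminorm dominated by the entries. -/
structure IsSeminormed (N : MatNorm V) : Prop where
  nonneg : ∀ (ι : Type) [Fintype ι] (x : Matrix ι ι V), 0 ≤ N ι x
  add_le : ∀ (ι : Type) [Fintype ι] (x y : Matrix ι ι V), N ι (x + y) ≤ N ι x + N ι y
  smul_le : ∀ (ι : Type) [Fintype ι] (c : ℂ) (x : Matrix ι ι V), N ι (c • x) ≤ ‖c‖ * N ι x
  le_sum : ∃ K : ℝ, 0 ≤ K ∧ ∀ (ι : Type) [Fintype ι] (x : Matrix ι ι V),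
    N ι x ≤ K * ∑ r, ∑ s, ‖x r s‖

theorem ampl_add {ρ ι : Type} (u : V →ₗ[ℂ] (ρ → ρ → ℂ)) (x y : Matrix ι ι V) :
    ampl u (x + y) = ampl u x + ampl u y := by
  ext; simp [ampl]

theorem ampl_smul {ρ ι : Type} (u : V →ₗ[ℂ] (ρ → ρ → ℂ)) (c : ℂ) (x : Matrix ι ι V) :
    ampl u (c • x) = c • ampl u x := by
  ext; simp [ampl]

theorem IsMatricial.isRelabelInvariant {N : MatNorm V} (h : IsMatricial N) :
    IsRelabelInvariant N := by
  refine isRelabelInvariant_of_le fun ι ι' _ _ e x => ?_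
  refine h.le_of_forall _ _ _ (h.nonneg _ _) fun m u hu => ?_
  rw [opNorm_ampl_submatrix]
  exact hu.opNorm_ampl_le x

theorem IsMatricial.isSeminormed {N : MatNorm V} (h : IsMatricial N) : IsSeminormed N where
  nonneg := h.nonneg
  add_le ι _ x y := by
    refine h.le_of_forall _ _ _ (add_nonneg (h.nonneg _ _) (h.nonneg _ _)) fun m u hu => ?_
    rw [ampl_add]
    exact (opNorm_add_le _ _).trans (add_le_add (hu.opNorm_ampl_le x) (hu.opNorm_ampl_le y))
  smul_le ι _ c x := by
    refine h.le_of_forall _ _ _ (mul_nonneg (norm_nonneg _) (h.nonneg _ _)) fun m u hu => ?_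
    rw [ampl_smul, opNorm_smul]
    exact mul_le_mul_of_nonneg_left (hu.opNorm_ampl_le x) (norm_nonneg _)
  le_sum := ⟨1, zero_le_one, fun ι _ x => by simpa using h.le_sum ι x⟩

end Matricial

/-! ### Scalars and concrete operator spaces are matricial -/

section Instances

theorem opNorm_le_sum {ι κ : Type} [Fintype ι] [Fintype κ] (A : Matrix ι κ ℂ) :
    opNorm A ≤ ∑ i, ∑ j, ‖A i j‖ := by
  refine opNorm_le_of_form
    (Finset.sum_nonneg fun _ _ => Finset.sum_nonneg fun _ _ => norm_nonneg _) fun w v => ?_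
  simp only [Finset.sum_mul]
  refine (norm_sum_le _ _).trans (Finset.sum_le_sum fun i _ => ?_)
  refine (norm_sum_le _ _).trans (Finset.sum_le_sum fun j _ => ?_)
  rw [norm_mul, norm_mul, norm_star, mul_comm ‖w i‖]
  gcongr
  · exact PiLp.norm_apply_le w i
  · exact PiLp.norm_apply_le v j

theorem isMatricial_scalarNorm : IsMatricial scalarNorm where
  nonneg _ _ _ := opNorm_nonneg _
  le_sum _ _ x := opNorm_le_sum x
  le_of_forall ι _ x C _ h := by
    let u : ℂ →ₗ[ℂ] (Fin 1 → Fin 1 → ℂ) :=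
      { toFun := fun z _ _ => z
        map_add' := fun _ _ => rfl
        map_smul' := fun _ _ => rfl }
    have key : ∀ (ι : Type) [Fintype ι] (x : Matrix ι ι ℂ), opNorm (ampl u x) = opNorm x := by
      intro ι _ x
      rw [← opNorm_submatrix x (Equiv.prodUnique ι (Fin 1)) (Equiv.prodUnique ι (Fin 1))]
      rfl
    have := h 1 u (ccMat_of_forall fun ι _ x => (key ι x).le)
    rwa [key] at this

variable {H : Type u} [NormedAddCommGroup H] [InnerProductSpace ℂ H] {ι : Type} [Fintype ι]

theorem inner_blockOp (x : Matrix ι ι (H →L[ℂ] H)) (w v : PiLp 2 (fun _ : ι => H)) :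
    inner ℂ w (blockOp x v) = ∑ i, ∑ j, inner ℂ (w i) (x i j (v j)) := by
  simp [PiLp.inner_apply, blockOp, inner_sum]

theorem norm_form_blockOp_le (x : Matrix ι ι (H →L[ℂ] H)) (w v : PiLp 2 (fun _ : ι => H)) :
    ‖∑ i, ∑ j, inner ℂ (w i) (x i j (v j))‖ ≤ ‖blockOp x‖ * ‖w‖ * ‖v‖ := by
  rw [← inner_blockOp]
  refine (norm_inner_le_norm _ _).trans ?_
  have := (blockOp x).le_opNorm v
  calc ‖w‖ * ‖blockOp x v‖ ≤ ‖w‖ * (‖blockOp x‖ * ‖v‖) := by gcongr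
    _ = _ := by ring

theorem norm_blockOp_le_of_form {x : Matrix ι ι (H →L[ℂ] H)} {C : ℝ} (hC : 0 ≤ C)
    (h : ∀ w v : PiLp 2 (fun _ : ι => H),
      ‖∑ i, ∑ j, inner ℂ (w i) (x i j (v j))‖ ≤ C * ‖w‖ * ‖v‖) : ‖blockOp x‖ ≤ C := by
  refine ContinuousLinearMap.opNorm_le_bound _ hC fun v => ?_
  have := h (blockOp x v) v
  rw [← inner_blockOp, inner_self_eq_norm_sq_to_K] at this
  simp only [norm_pow, RCLike.norm_ofReal, abs_norm] at this
  rcases (norm_nonneg (blockOp x v)).eq_or_lt with h0 | h0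
  · rw [← h0]; positivity
  · nlinarith

/-- The compression of an operator to the span of a finite orthonormal family. -/
noncomputable def compression (E : Submodule ℂ (H →L[ℂ] H)) {m : ℕ} (b : Fin m → H) :
    E →ₗ[ℂ] (Fin m → Fin m → ℂ) where
  toFun T := fun g h => inner ℂ (b g) ((T : H →L[ℂ] H) (b h))
  map_add' S T := by ext; simp
  map_smul' c T := by ext; simp

theorem norm_toLp_sum_smul {m : ℕ} {b : Fin m → H} (hb : Orthonormal ℂ b)
    (v : EuclideanSpace ℂ (ι × Fin m)) :
    ‖(WithLp.toLp 2 (fun i => ∑ g, v (i, g) • b g) : PiLp 2 (fun _ : ι => H))‖ = ‖v‖ := by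
  rw [← sq_eq_sq₀ (norm_nonneg _) (norm_nonneg _), PiLp.norm_sq_eq_of_L2,
    EuclideanSpace.norm_sq_eq, Fintype.sum_prod_type]
  refine Finset.sum_congr rfl fun i _ => ?_
  have := hb.inner_sum (fun g => v (i, g)) (fun g => v (i, g)) Finset.univ
  rw [inner_self_eq_norm_sq_to_K] at this
  have h2 : ∑ g, (starRingEnd ℂ) (v (i, g)) * v (i, g) = ((∑ g, ‖v (i, g)‖ ^ 2 : ℝ) : ℂ) := by
    push_cast
    exact Finset.sum_congr rfl fun g _ => by
      rw [mul_comm, Complex.mul_conj, Complex.normSq_eq_norm_sq]; push_cast; rfl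
  rw [h2] at this
  exact Complex.ofReal_injective (by push_cast at this ⊢; exact this)

theorem form_ampl_compression (E : Submodule ℂ (H →L[ℂ] H)) {m : ℕ} (b : Fin m → H)
    (x : Matrix ι ι E) (w v : ι × Fin m → ℂ) :
    ∑ p, ∑ q, star (w p) * ampl (compression E b) x p q * v q =
      ∑ i, ∑ j, inner ℂ (∑ g, w (i, g) • b g) ((x i j : H →L[ℂ] H) (∑ h, v (j, h) • b h)) := by
  simp only [Fintype.sum_prod_type]
  refine Finset.sum_congr rfl fun i _ => ?_
  rw [Finset.sum_comm]
  refine Finset.sum_congr rfl fun j _ => ?_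
  simp only [map_sum, map_smul, sum_inner, inner_sum, inner_smul_left, inner_smul_right]
  simp only [Finset.mul_sum]
  rw [Finset.sum_comm]
  refine Finset.sum_congr rfl fun g _ => Finset.sum_congr rfl fun h _ => ?_
  simp only [ampl, compression, Matrix.of_apply, LinearMap.coe_mk, AddHom.coe_mk,
    starRingEnd_apply]
  ring

theorem subspaceNorm_eq (E : Submodule ℂ (H →L[ℂ] H)) (x : Matrix ι ι E) :
    subspaceNorm E ι x = ‖blockOp (x.map fun e : E => (e : H →L[ℂ] H))‖ := rfl

theorem subspaceNorm_nonneg (E : Submodule ℂ (H →L[ℂ] H)) (x : Matrix ι ι E) :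
    0 ≤ subspaceNorm E ι x := by
  rw [subspaceNorm_eq]
  exact ContinuousLinearMap.opNorm_nonneg _

theorem subspaceNorm_le_sum (E : Submodule ℂ (H →L[ℂ] H)) (x : Matrix ι ι E) :
    subspaceNorm E ι x ≤ ∑ r, ∑ s, ‖x r s‖ := by
  rw [subspaceNorm_eq]
  refine norm_blockOp_le_of_form
    (Finset.sum_nonneg fun _ _ => Finset.sum_nonneg fun _ _ => norm_nonneg _) fun w v => ?_
  simp only [Finset.sum_mul]
  refine (norm_sum_le _ _).trans (Finset.sum_le_sum fun i _ => ?_)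
  refine (norm_sum_le _ _).trans (Finset.sum_le_sum fun j _ => ?_)
  calc _ ≤ ‖w i‖ * (‖x i j‖ * ‖v j‖) := (norm_inner_le_norm _ _).trans (by
        gcongr
        exact (x i j : H →L[ℂ] H).le_opNorm _)
    _ ≤ ‖w‖ * (‖x i j‖ * ‖v‖) := by
        gcongr
        · exact PiLp.norm_apply_le w i
        · exact PiLp.norm_apply_le v j
    _ = _ := by ring

theorem ccMat_compression (E : Submodule ℂ (H →L[ℂ] H)) {m : ℕ} {b : Fin m → H}
    (hb : Orthonormal ℂ b) : CCMat (subspaceNorm E) (compression E b) := by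
  refine ccMat_of_forall fun ι _ x => opNorm_le_of_form (subspaceNorm_nonneg E x) fun w v => ?_
  rw [form_ampl_compression, subspaceNorm_eq]
  have := norm_form_blockOp_le (x.map fun e : E => (e : H →L[ℂ] H))
    (WithLp.toLp 2 fun i => ∑ g, w (i, g) • b g) (WithLp.toLp 2 fun i => ∑ g, v (i, g) • b g)
  rwa [norm_toLp_sum_smul hb, norm_toLp_sum_smul hb] at this

/-- The form at `w`, `v` sees only the span of their finitely many components. Compressing to this
span is a complete contraction into a matrix algebra that already computes the form. -/
theorem subspaceNorm_le_of_forall (E : Submodule ℂ (H →L[ℂ] H)) (x : Matrix ι ι E) {C : ℝ}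
    (hC : 0 ≤ C) (h : ∀ (m : ℕ) (u : E →ₗ[ℂ] (Fin m → Fin m → ℂ)), CCMat (subspaceNorm E) u →
      opNorm (ampl u x) ≤ C) : subspaceNorm E ι x ≤ C := by
  rw [subspaceNorm_eq]
  refine norm_blockOp_le_of_form hC fun w v => ?_
  let F : Submodule ℂ H := Submodule.span ℂ (Set.range w ∪ Set.range v)
  have hfin : FiniteDimensional ℂ F :=
    FiniteDimensional.span_of_finite ℂ ((Set.finite_range w).union (Set.finite_range v))
  let b := stdOrthonormalBasis ℂ F
  let b' : Fin (Module.finrank ℂ F) → H := fun g => (b g : H)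
  have hb : Orthonormal ℂ b' := b.orthonormal.comp_linearIsometry F.subtypeₗᵢ
  have hcc : CCMat (subspaceNorm E) (compression E b') := ccMat_compression E hb
  have hrep : ∀ ξ : ι → H, (∀ i, ξ i ∈ F) → ∃ c : EuclideanSpace ℂ (ι × Fin (Module.finrank ℂ F)),
      ∀ i, ξ i = ∑ g, c (i, g) • b' g := by
    intro ξ hξ
    refine ⟨WithLp.toLp 2 fun p => b.repr ⟨ξ p.1, hξ p.1⟩ p.2, fun i => ?_⟩
    have := congrArg (Subtype.val) (b.sum_repr ⟨ξ i, hξ i⟩)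
    refine this.symm.trans ?_
    simp [b']
  obtain ⟨c, hc⟩ := hrep w fun i => Submodule.subset_span (Or.inl ⟨i, rfl⟩)
  obtain ⟨c', hc'⟩ := hrep v fun i => Submodule.subset_span (Or.inr ⟨i, rfl⟩)
  have h1 := norm_form_le (ampl (compression E b') x) c c'
  rw [form_ampl_compression] at h1
  have hw : ‖w‖ = ‖c‖ := by
    rw [← norm_toLp_sum_smul hb c]
    congr 1
    ext i
    exact hc i
  have hv : ‖v‖ = ‖c'‖ := by
    rw [← norm_toLp_sum_smul hb c']
    congr 1
    ext i
    exact hc' i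
  rw [hw, hv]
  have h2 := h _ _ hcc
  simp only [Matrix.map_apply, hc, hc']
  refine h1.trans ?_
  gcongr

theorem isMatricial_subspaceNorm (E : Submodule ℂ (H →L[ℂ] H)) : IsMatricial (subspaceNorm E) where
  nonneg _ _ x := subspaceNorm_nonneg E x
  le_sum _ _ x := subspaceNorm_le_sum E x
  le_of_forall _ _ x _ hC h := subspaceNorm_le_of_forall E x hC h

end Instances
-- The `ℓ_∞` and `ℓ_1` direct sums
section Sums

variable {κ : Type} {V : κ → Type u}

theorem le_sumInftyNorm [Finite κ] (N : ∀ i, MatNorm (V i)) {ι : Type} [Fintype ι]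
    (x : Matrix ι ι (∀ i, V i)) (i : κ) :
    N i ι (Matrix.of fun r s => x r s i) ≤ sumInftyNorm N ι x :=
  le_ciSup (f := fun i => N i ι (Matrix.of fun r s => x r s i)) (Set.finite_range _).bddAbove i

theorem sumInftyNorm_le {N : ∀ i, MatNorm (V i)} {ι : Type} [Fintype ι]
    {x : Matrix ι ι (∀ i, V i)} {C : ℝ} (hC : 0 ≤ C)
    (h : ∀ i, N i ι (Matrix.of fun r s => x r s i) ≤ C) : sumInftyNorm N ι x ≤ C :=
  Real.iSup_le h hC

theorem sumInftyNorm_nonneg {N : ∀ i, MatNorm (V i)} {ι : Type} [Fintype ι]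
    (h : ∀ i (x : Matrix ι ι (V i)), 0 ≤ N i ι x) (x : Matrix ι ι (∀ i, V i)) :
    0 ≤ sumInftyNorm N ι x :=
  Real.iSup_nonneg fun i => h i _

theorem isRelabelInvariant_sumInftyNorm {N : ∀ i, MatNorm (V i)}
    (h : ∀ i, IsRelabelInvariant (N i)) : IsRelabelInvariant (sumInftyNorm N) := by
  intro ι ι' _ _ e x
  unfold sumInftyNorm
  congr 1
  funext i
  exact h i ι ι' e (Matrix.of fun r s => x r s i)

variable [Fintype κ] [∀ i, AddCommGroup (V i)] [∀ i, Module ℂ (V i)]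

/-- The map `⊕ x_i ↦ ∑ φ_i(x_i)`. -/
noncomputable def sumMap {ρ : Type} (φ : ∀ i, V i →ₗ[ℂ] (ρ → ρ → ℂ)) :
    (∀ i, V i) →ₗ[ℂ] (ρ → ρ → ℂ) :=
  ∑ i, φ i ∘ₗ LinearMap.proj i

theorem sumMap_apply {ρ : Type} (φ : ∀ i, V i →ₗ[ℂ] (ρ → ρ → ℂ)) (x : ∀ i, V i) (a b : ρ) :
    sumMap φ x a b = ∑ i, φ i (x i) a b := by
  simp [sumMap, Finset.sum_apply]

variable {N : ∀ i, MatNorm (V i)} {ι : Type} [Fintype ι]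

theorem opNorm_ampl_sumMap_le_sum {ρ : Type} [Fintype ρ] {φ : ∀ i, V i →ₗ[ℂ] (ρ → ρ → ℂ)}
    (hφ : ∀ i, CCMat (N i) (φ i)) (x : Matrix ι ι (∀ i, V i)) :
    opNorm (ampl (sumMap φ) x) ≤ ∑ i, N i ι (Matrix.of fun r s => x r s i) := by
  have : ampl (sumMap φ) x = ∑ i, ampl (φ i) (Matrix.of fun r s => x r s i) := by
    ext p q
    simp [ampl, sumMap_apply, Matrix.sum_apply]
  rw [this]
  exact (opNorm_sum_le _ _).trans (Finset.sum_le_sum fun i _ => (hφ i).opNorm_ampl_le _)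

theorem sumOneNorm_eq (x : Matrix ι ι (∀ i, V i)) :
    sumOneNorm N ι x = sSup {c : ℝ | ∃ (m : ℕ) (φ : ∀ i, V i →ₗ[ℂ] (Fin m → Fin m → ℂ)),
      (∀ i, CCMat (N i) (φ i)) ∧ c = opNorm (ampl (sumMap φ) x)} := by
  unfold sumOneNorm
  congr! 8 with c m φ
  simp only [ampl, minNorm, scalarNorm, sumMap_apply, Matrix.of_apply, Finset.sum_apply]

theorem le_sumOneNorm {ρ : Type} [Fintype ρ] {φ : ∀ i, V i →ₗ[ℂ] (ρ → ρ → ℂ)}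
    (hφ : ∀ i, CCMat (N i) (φ i)) (x : Matrix ι ι (∀ i, V i)) :
    opNorm (ampl (sumMap φ) x) ≤ sumOneNorm N ι x := by
  rw [sumOneNorm_eq]
  -- The triangle inequality shows that the set under the supremum is bounded; relabelling brings
  -- `ρ` into the form `Fin m` used in the definition.
  refine le_csSup ⟨∑ i, N i ι (Matrix.of fun r s => x r s i), ?_⟩
    ⟨_, fun i => relabel (Fintype.equivFin ρ).symm ∘ₗ φ i, fun i => (hφ i).relabel _, ?_⟩
  · rintro c ⟨m, φ, hφ, rfl⟩
    exact opNorm_ampl_sumMap_le_sum hφ x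
  · rw [← opNorm_ampl_relabel (Fintype.equivFin ρ).symm]
    congr 2
    ext x a b
    simp [relabel, sumMap_apply]

theorem sumOneNorm_le {x : Matrix ι ι (∀ i, V i)} {C : ℝ} (hC : 0 ≤ C)
    (h : ∀ (m : ℕ) (φ : ∀ i, V i →ₗ[ℂ] (Fin m → Fin m → ℂ)), (∀ i, CCMat (N i) (φ i)) →
      opNorm (ampl (sumMap φ) x) ≤ C) : sumOneNorm N ι x ≤ C := by
  rw [sumOneNorm_eq]
  refine Real.sSup_le ?_ hC
  rintro c ⟨m, φ, hφ, rfl⟩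
  exact h m φ hφ

theorem sumOneNorm_nonneg (x : Matrix ι ι (∀ i, V i)) : 0 ≤ sumOneNorm N ι x := by
  refine Real.sSup_nonneg ?_
  rintro c ⟨m, φ, -, rfl⟩
  exact opNorm_nonneg _

theorem isRelabelInvariant_sumOneNorm : IsRelabelInvariant (sumOneNorm N) := by
  intro ι ι' _ _ e x
  rw [sumOneNorm_eq, sumOneNorm_eq]
  simp only [opNorm_ampl_submatrix]

end Sums

/-! ### The projective tensor product with the trace class -/

section Projective

variable {V : Type u} [AddCommGroup V] [Module ℂ V] {N : MatNorm V} {d : ℕ} {ι : Type} [Fintype ι]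

/-- The element `x ⊗ y` of `M_l[S_1^d] ⊗ M_m[V]`. -/
def tmul {n l μ : Type} (x : Matrix l l (n → n → ℂ)) (y : Matrix μ μ V) :
    Matrix (l × μ) (l × μ) (n → n → V) :=
  Matrix.of fun P Q a b => x P.1 Q.1 a b • y P.2 Q.2

/-- The two-sided scalar multiple `α t β` of a matrix over a vector space. -/
def sandwich {X : Type u} [AddCommGroup X] [Module ℂ X] {τ : Type} [Fintype τ] (α : Matrix ι τ ℂ)
    (t : Matrix τ τ X) (β : Matrix τ ι ℂ) : Matrix ι ι X :=
  Matrix.of fun r s => ∑ P, ∑ Q, (α r P * β Q s) • t P Q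

theorem projNorm_eq (t : Matrix ι ι (Fin d → Fin d → V)) :
    projNorm (Fin d) N ι t = sInf {c : ℝ | ∃ (l m : ℕ)
      (α : Matrix ι (Fin l × Fin m) ℂ) (β : Matrix (Fin l × Fin m) ι ℂ)
      (x : Matrix (Fin l) (Fin l) (Fin d → Fin d → ℂ)) (y : Matrix (Fin m) (Fin m) V),
      t = sandwich α (tmul x y) β ∧
      c = opNorm α * traceNorm (Fin d) (Fin l) x * N (Fin m) y * opNorm β} := by
  unfold projNorm
  congr! 16 with c l m α β x y
  rw [← Matrix.ext_iff]
  refine forall_congr' fun r => forall_congr' fun s => ?_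
  rw [funext_iff]
  refine forall_congr' fun a => ?_
  rw [funext_iff]
  refine forall_congr' fun b => ?_
  have : sandwich α (tmul x y) β r s a b =
      ∑ i, ∑ g, ∑ j, ∑ h, (α r (i, g) * x i j a b * β (j, h) s) • y g h := by
    simp only [sandwich, tmul, Matrix.of_apply, Finset.sum_apply, Pi.smul_apply, smul_smul,
      Fintype.sum_prod_type]
    refine Finset.sum_congr rfl fun i _ => Finset.sum_congr rfl fun g _ =>
      Finset.sum_congr rfl fun j _ => Finset.sum_congr rfl fun h _ => ?_
    congr 1
    ring
  rw [this]

theorem sandwich_tmul_relabel {l μ μ' : Type} [Fintype l] [Fintype μ] [Fintype μ'] (e : μ' ≃ μ)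
    (α : Matrix ι (l × μ) ℂ) (β : Matrix (l × μ) ι ℂ) (x : Matrix l l (Fin d → Fin d → ℂ))
    (y : Matrix μ μ V) :
    sandwich (α.submatrix (Equiv.refl ι) ((Equiv.refl l).prodCongr e))
      (tmul x (y.submatrix e e)) (β.submatrix ((Equiv.refl l).prodCongr e) (Equiv.refl ι)) =
      sandwich α (tmul x y) β := by
  refine Matrix.ext fun r s => ?_
  simp only [sandwich, Matrix.of_apply]
  refine Fintype.sum_equiv ((Equiv.refl l).prodCongr e) _
    (fun P => ∑ Q, (α r P * β Q s) • tmul x y P Q) fun P => ?_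
  exact Fintype.sum_equiv ((Equiv.refl l).prodCongr e) _
    (fun Q => (α r ((Equiv.refl l).prodCongr e P) * β Q s) •
      tmul x y ((Equiv.refl l).prodCongr e P) Q) fun Q => rfl

theorem projNorm_bddBelow (hN : ∀ (m : ℕ) (y : Matrix (Fin m) (Fin m) V), 0 ≤ N (Fin m) y)
    (t : Matrix ι ι (Fin d → Fin d → V)) : 0 ∈ lowerBounds {c : ℝ | ∃ (l m : ℕ)
      (α : Matrix ι (Fin l × Fin m) ℂ) (β : Matrix (Fin l × Fin m) ι ℂ)
      (x : Matrix (Fin l) (Fin l) (Fin d → Fin d → ℂ)) (y : Matrix (Fin m) (Fin m) V),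
      t = sandwich α (tmul x y) β ∧
      c = opNorm α * traceNorm (Fin d) (Fin l) x * N (Fin m) y * opNorm β} := by
  rintro c ⟨l, m, α, β, x, y, -, rfl⟩
  exact mul_nonneg (mul_nonneg (mul_nonneg (opNorm_nonneg _) (traceNorm_nonneg _)) (hN m y))
    (opNorm_nonneg _)

theorem projNorm_nonneg (hN : ∀ (m : ℕ) (y : Matrix (Fin m) (Fin m) V), 0 ≤ N (Fin m) y)
    (t : Matrix ι ι (Fin d → Fin d → V)) : 0 ≤ projNorm (Fin d) N ι t := by
  rw [projNorm_eq]
  exact Real.sInf_nonneg (projNorm_bddBelow hN t)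

theorem projNorm_sandwich_le (hN : ∀ (m : ℕ) (y : Matrix (Fin m) (Fin m) V), 0 ≤ N (Fin m) y)
    {l m : ℕ} (α : Matrix ι (Fin l × Fin m) ℂ) (β : Matrix (Fin l × Fin m) ι ℂ)
    (x : Matrix (Fin l) (Fin l) (Fin d → Fin d → ℂ)) (y : Matrix (Fin m) (Fin m) V) :
    projNorm (Fin d) N ι (sandwich α (tmul x y) β) ≤
      opNorm α * traceNorm (Fin d) (Fin l) x * N (Fin m) y * opNorm β := by
  rw [projNorm_eq]
  exact csInf_le ⟨0, projNorm_bddBelow hN _⟩ ⟨l, m, α, β, x, y, rfl, rfl⟩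

theorem projNorm_sandwich_relabel_le
    (hN : ∀ (m : ℕ) (y : Matrix (Fin m) (Fin m) V), 0 ≤ N (Fin m) y)
    (hrel : IsRelabelInvariant N) {l : ℕ} {μ : Type} [Fintype μ]
    (α : Matrix ι (Fin l × μ) ℂ) (β : Matrix (Fin l × μ) ι ℂ)
    (x : Matrix (Fin l) (Fin l) (Fin d → Fin d → ℂ)) (y : Matrix μ μ V) :
    projNorm (Fin d) N ι (sandwich α (tmul x y) β) ≤
      opNorm α * traceNorm (Fin d) (Fin l) x * N μ y * opNorm β := by
  have e := (Fintype.equivFin μ).symm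
  have h := projNorm_sandwich_le hN (α.submatrix (Equiv.refl ι) ((Equiv.refl _).prodCongr e))
    (β.submatrix ((Equiv.refl _).prodCongr e) (Equiv.refl ι)) x (y.submatrix e e)
  rwa [sandwich_tmul_relabel, opNorm_submatrix, opNorm_submatrix, hrel] at h

theorem mul_mul_mul_le_of_le_one {a x y b : ℝ} (ha : a ≤ 1) (hx : x ≤ 1) (hb : b ≤ 1)
    (hx0 : 0 ≤ x) (hb0 : 0 ≤ b) (hy : 0 ≤ y) : a * x * y * b ≤ y :=
  calc a * x * y * b ≤ 1 * 1 * y * 1 := by gcongr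
    _ = y := by ring

theorem opNorm_one_le {τ : Type} [Fintype τ] [DecidableEq τ] :
    opNorm (1 : Matrix τ τ ℂ) ≤ 1 := by
  rw [← Real.sqrt_one]
  exact opNorm_le_sqrt zero_le_one (by simp)

/-- The normalized row isometry behind the representation of `t` by `unitElement ⊗ d t`. -/
noncomputable def spread (ι : Type) [DecidableEq ι] (d : ℕ) :
    Matrix ι (Fin d × (ι × Fin d)) ℂ :=
  Matrix.of fun r P => if P.2 = (r, P.1) then (((Real.sqrt d)⁻¹ : ℝ) : ℂ) else 0

/-- The rows are orthonormal: each has `d` entries `1 / √d`, and different rows have disjoint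
supports. -/
theorem opNorm_spread_le [DecidableEq ι] (hd : 0 < d) : opNorm (spread ι d) ≤ 1 := by
  rw [← opNorm_conjTranspose, ← Real.sqrt_one]
  refine opNorm_le_sqrt zero_le_one ?_
  ext r s
  have h0 : (0 : ℝ) < d := by exact_mod_cast hd
  have h1 : ((Real.sqrt d : ℝ) : ℂ) * ((Real.sqrt d : ℝ) : ℂ) = d := by
    rw [← Complex.ofReal_mul, Real.mul_self_sqrt h0.le, Complex.ofReal_natCast]
  have h2 : ((Real.sqrt d : ℝ) : ℂ) ≠ 0 := by
    exact_mod_cast (Real.sqrt_pos.2 h0).ne'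
  have h3 : (d : ℂ) ≠ 0 := by exact_mod_cast hd.ne'
  have h4 : (d : ℂ) * (((Real.sqrt d : ℝ) : ℂ)⁻¹ * ((Real.sqrt d : ℝ) : ℂ)⁻¹) = 1 := by
    rw [← mul_inv, h1, mul_inv_cancel₀ h3]
  simp only [Matrix.conjTranspose_conjTranspose, Matrix.mul_apply, Matrix.conjTranspose_apply,
    spread, Matrix.of_apply, Fintype.sum_prod_type, Prod.mk.injEq, Matrix.smul_apply,
    Matrix.one_apply]
  by_cases hrs : r = s
  · subst hrs
    simp [ite_and, h4]
  · simp [ite_and, hrs]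

/-- The unit element places the entry of `t` at `(a, b)` into the component `E_{ab}`; the factor `d`
compensates the two normalizations `1 / √d`. -/
theorem sandwich_spread [DecidableEq ι] (hd : 0 < d) (t : Matrix ι ι (Fin d → Fin d → V)) :
    sandwich (spread ι d)
      (tmul (unitElement (Fin d)) (Matrix.of fun P Q : ι × Fin d => (d : ℂ) • t P.1 Q.1 P.2 Q.2))
      (spread ι d).transpose = t := by
  have h0 : (0 : ℝ) < d := by exact_mod_cast hd
  have h1 : ((Real.sqrt d : ℝ) : ℂ) * ((Real.sqrt d : ℝ) : ℂ) = d := by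
    rw [← Complex.ofReal_mul, Real.mul_self_sqrt h0.le, Complex.ofReal_natCast]
  have h3 : (d : ℂ) ≠ 0 := by exact_mod_cast hd.ne'
  have h4 : (((Real.sqrt d : ℝ) : ℂ)⁻¹ * ((Real.sqrt d : ℝ) : ℂ)⁻¹) * (d : ℂ) = 1 := by
    rw [← mul_inv, h1, inv_mul_cancel₀ h3]
  ext r s a b
  simp only [sandwich, tmul, spread, unitElement, Matrix.of_apply, Matrix.transpose_apply,
    Finset.sum_apply, Pi.smul_apply, smul_smul, Fintype.sum_prod_type, Prod.mk.injEq, ite_and]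
  simp [ite_smul, h4]

/-- The trace class norm is at most `d` times the operator norm. -/
theorem projNorm_le_minNorm (hd : 0 < d)
    (hN : ∀ (m : ℕ) (y : Matrix (Fin m) (Fin m) V), 0 ≤ N (Fin m) y)
    (hrel : IsRelabelInvariant N) (hnn : ∀ y : Matrix (ι × Fin d) (ι × Fin d) V, 0 ≤ N _ y)
    (t : Matrix ι ι (Fin d → Fin d → V)) :
    projNorm (Fin d) N ι t ≤ minNorm (Fin d) N ι ((d : ℂ) • t) := by
  classical
  have h := projNorm_sandwich_relabel_le hN hrel (spread ι d) (spread ι d).transpose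
    (unitElement (Fin d)) (Matrix.of fun P Q : ι × Fin d => (d : ℂ) • t P.1 Q.1 P.2 Q.2)
  rw [sandwich_spread hd] at h
  have h1 : opNorm (spread ι d).transpose ≤ 1 := by
    have : (spread ι d).transpose = (spread ι d).conjTranspose := by
      ext P r
      simp only [spread, Matrix.transpose_apply, Matrix.conjTranspose_apply, Matrix.of_apply]
      split_ifs <;> simp
    rw [this, opNorm_conjTranspose]
    exact opNorm_spread_le hd
  exact h.trans (mul_mul_mul_le_of_le_one (opNorm_spread_le hd) (traceNorm_unitElement_le _) h1
    (traceNorm_nonneg _) (opNorm_nonneg _) (hnn _))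

/-- The infimum defining `projNorm` is over a nonempty set, so lower bounds can be checked on
representations. -/
theorem exists_sandwich_eq (hd : 0 < d) (t : Matrix ι ι (Fin d → Fin d → V)) :
    ∃ (l m : ℕ) (α : Matrix ι (Fin l × Fin m) ℂ) (β : Matrix (Fin l × Fin m) ι ℂ)
      (x : Matrix (Fin l) (Fin l) (Fin d → Fin d → ℂ)) (y : Matrix (Fin m) (Fin m) V),
      t = sandwich α (tmul x y) β := by
  classical
  have e := (Fintype.equivFin (ι × Fin d)).symm
  exact ⟨_, _, _, _, _, _, ((sandwich_tmul_relabel e _ _ _ _).trans (sandwich_spread hd t)).symm⟩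

theorem le_projNorm (hd : 0 < d) {t : Matrix ι ι (Fin d → Fin d → V)} {C : ℝ}
    (h : ∀ (l m : ℕ) (α : Matrix ι (Fin l × Fin m) ℂ) (β : Matrix (Fin l × Fin m) ι ℂ)
      (x : Matrix (Fin l) (Fin l) (Fin d → Fin d → ℂ)) (y : Matrix (Fin m) (Fin m) V),
      t = sandwich α (tmul x y) β →
      C ≤ opNorm α * traceNorm (Fin d) (Fin l) x * N (Fin m) y * opNorm β) :
    C ≤ projNorm (Fin d) N ι t := by
  rw [projNorm_eq]
  obtain ⟨l, m, α, β, x, y, ht⟩ := exists_sandwich_eq hd t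
  refine le_csInf ⟨_, l, m, α, β, x, y, ht, rfl⟩ ?_
  rintro c ⟨l, m, α, β, x, y, ht, rfl⟩
  exact h l m α β x y ht

theorem projNorm_tmul_unitElement_le
    (hN : ∀ (m : ℕ) (y : Matrix (Fin m) (Fin m) V), 0 ≤ N (Fin m) y)
    (hrel : IsRelabelInvariant N) {μ : Type} [Fintype μ] (y : Matrix μ μ V) (hy : 0 ≤ N μ y) :
    projNorm (Fin d) N (Fin d × μ) (tmul (unitElement (Fin d)) y) ≤ N μ y := by
  classical
  have h := projNorm_sandwich_relabel_le hN hrel (1 : Matrix (Fin d × μ) (Fin d × μ) ℂ) 1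
    (unitElement (Fin d)) y
  have h1 : sandwich (1 : Matrix (Fin d × μ) (Fin d × μ) ℂ) (tmul (unitElement (Fin d)) y) 1 =
      tmul (unitElement (Fin d)) y := by
    ext P Q : 2
    simp [sandwich, Matrix.one_apply]
  rw [h1] at h
  exact h.trans (mul_mul_mul_le_of_le_one opNorm_one_le (traceNorm_unitElement_le _) opNorm_one_le
    (traceNorm_nonneg _) (opNorm_nonneg _) hy)

/-- Two-sided scalar multiplication, amplified by a map into a matrix algebra. -/
theorem opNorm_ampl_sandwich_le {X : Type u} [AddCommGroup X] [Module ℂ X] {ρ τ : Type}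
    [Fintype ρ] [Fintype τ] (Φ : X →ₗ[ℂ] (ρ → ρ → ℂ)) (α : Matrix ι τ ℂ) (t : Matrix τ τ X)
    (β : Matrix τ ι ℂ) :
    opNorm (ampl Φ (sandwich α t β)) ≤ opNorm α * opNorm (ampl Φ t) * opNorm β := by
  classical
  -- Linearity of `Φ` lets the scalar matrices pass through it; they act as `α ⊗ 1` and `β ⊗ 1`.
  have h : ampl Φ (sandwich α t β) =
      (Matrix.blockDiagonal fun _ : ρ => α) * ampl Φ t * (Matrix.blockDiagonal fun _ : ρ => β) := by
    ext p q
    simp only [ampl, sandwich, Matrix.of_apply, Matrix.mul_apply, Fintype.sum_prod_type,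
      Matrix.blockDiagonal_apply, map_sum, map_smul, Finset.sum_apply, Pi.smul_apply, smul_eq_mul]
    simp only [ite_mul, mul_ite, zero_mul, mul_zero, Finset.sum_ite_eq, Finset.sum_ite_eq',
      Finset.mem_univ, if_true, Finset.sum_mul]
    rw [Finset.sum_comm]
    exact Finset.sum_congr rfl fun _ _ => Finset.sum_congr rfl fun _ _ => by ring
  rw [h]
  have hb : ∀ {a b : Type} [Fintype a] [Fintype b] (A : Matrix a b ℂ),
      opNorm (Matrix.blockDiagonal fun _ : ρ => A) ≤ opNorm A := fun A =>
    opNorm_blockDiagonal_le (opNorm_nonneg A) fun _ => le_rfl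
  have h1 := opNorm_nonneg (Matrix.blockDiagonal fun _ : ρ => β)
  have h2 := opNorm_nonneg (ampl Φ t)
  have h3 := opNorm_nonneg α
  calc _ ≤ _ := opNorm_mul_le _ _
    _ ≤ _ := mul_le_mul_of_nonneg_right (opNorm_mul_le _ _) h1
    _ ≤ _ := by
      gcongr
      · exact hb α
      · exact hb β

/-- A map out of the projective tensor product is completely contractive if it is so on
elementary tensors. -/
theorem ccMat_projNorm (hd : 0 < d) {ρ : Type} [Fintype ρ]
    {Φ : (Fin d → Fin d → V) →ₗ[ℂ] (ρ → ρ → ℂ)}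
    (h : ∀ (l m : ℕ) (x : Matrix (Fin l) (Fin l) (Fin d → Fin d → ℂ))
      (y : Matrix (Fin m) (Fin m) V),
      opNorm (ampl Φ (tmul x y)) ≤ traceNorm (Fin d) (Fin l) x * N (Fin m) y) :
    CCMat (projNorm (Fin d) N) Φ := by
  refine ccMat_of_forall fun ι _ t => le_projNorm hd fun l m α β x y ht => ?_
  rw [ht]
  have h1 := opNorm_nonneg α
  have h2 := opNorm_nonneg β
  calc _ ≤ _ := opNorm_ampl_sandwich_le Φ α _ β
    _ ≤ opNorm α * (traceNorm (Fin d) (Fin l) x * N (Fin m) y) * opNorm β := by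
      gcongr
      exact h l m x y
    _ = _ := by ring

end Projective
-- Kraus sums over a matricial space and under slicing
section Bounds

theorem sum_comm_pairs {α β γ δ M : Type*} [Fintype α] [Fintype β] [Fintype γ] [Fintype δ]
    [AddCommMonoid M] (F : α → β → γ → δ → M) :
    ∑ a, ∑ b, ∑ c, ∑ d, F a b c d = ∑ c, ∑ d, ∑ a, ∑ b, F a b c d := by
  have := Finset.sum_comm (s := (Finset.univ : Finset (α × β)))
    (t := (Finset.univ : Finset (γ × δ))) (f := fun x y => F x.1 x.2 y.1 y.2)
  simpa only [Fintype.sum_prod_type] using this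

theorem sum_comm_triple {α β γ M : Type*} [Fintype α] [Fintype β] [Fintype γ]
    [AddCommMonoid M] (F : α → β → γ → M) :
    ∑ a, ∑ b, ∑ c, F a b c = ∑ c, ∑ a, ∑ b, F a b c := by
  have := Finset.sum_comm (s := (Finset.univ : Finset (α × β)))
    (t := (Finset.univ : Finset γ)) (f := fun x y => F x.1 x.2 y)
  simpa only [Fintype.sum_prod_type] using this

theorem opNorm_conjTranspose_mul_map_star {μ σ : Type} [Fintype μ] [DecidableEq σ]
    {M : Matrix μ σ ℂ} {c : ℝ}
    (h : M.conjTranspose * M = (c : ℂ) • (1 : Matrix σ σ ℂ)) :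
    (M.map star).conjTranspose * M.map star = (c : ℂ) • (1 : Matrix σ σ ℂ) := by
  have h1 : (M.map star).conjTranspose * M.map star = (M.conjTranspose * M).map star := by
    ext i j
    simp [Matrix.mul_apply]
  rw [h1, h]
  ext i j
  by_cases hij : i = j <;> simp [hij]

variable {ι l μ ν r σ n : Type} [Fintype ι] [Fintype l] [Fintype μ] [Fintype ν] [Fintype r]
  [Fintype σ] [Fintype n]

/-- The matrix is the slice by `x` of `D = ∑_s Y_s ⊗ L_s R_s`, up to reordering tensor factors. This
is the common form of `J` into `ℓ_1` and `W` out of `ℓ_∞`, tested on elementary tensors. -/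
theorem opNorm_slice_rankOne_le (x : Matrix l l (n → n → ℂ)) (L : Matrix (ν × n) σ ℂ)
    (R : Matrix σ (ν × n) ℂ) {Y : σ → Matrix (μ × r) (μ × r) ℂ} {C : ℝ} (hC : 0 ≤ C)
    (hY : ∀ s, opNorm (Y s) ≤ C) :
    opNorm (Matrix.of fun P Q : (l × μ) × (ν × r) => ∑ a, ∑ b, x P.1.1 Q.1.1 a b *
      ∑ s, L (P.2.1, a) s * Y s (P.1.2, P.2.2) (Q.1.2, Q.2.2) * R s (Q.2.1, b)) ≤
      traceNorm n l x * (opNorm L * C * opNorm R) := by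
  set D : Matrix ((μ × r) × (ν × n)) ((μ × r) × (ν × n)) ℂ :=
    Matrix.of fun p q => ∑ s, L p.2 s * Y s p.1 q.1 * R s q.2
  have h1 : opNorm D ≤ opNorm L * C * opNorm R := opNorm_sum_rankOne_le L R hC hY
  have h2 := opNorm_slice_le x (D.submatrix (Equiv.prodAssoc (μ × r) ν n)
    (Equiv.prodAssoc (μ × r) ν n))
  rw [opNorm_submatrix] at h2
  let E : (l × μ) × (ν × r) ≃ ((μ × r) × ν) × l :=
    { toFun := fun P => (((P.1.2, P.2.2), P.2.1), P.1.1)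
      invFun := fun P => ((P.2, P.1.1.1), (P.1.2, P.1.1.2))
      left_inv := fun _ => rfl
      right_inv := fun _ => rfl }
  rw [← opNorm_submatrix _ E E] at h2
  exact h2.trans (mul_le_mul_of_nonneg_left h1 (traceNorm_nonneg x))

variable {V : Type u} [NormedAddCommGroup V] [NormedSpace ℂ V]

/-- The norm of `∑_c (1 ⊗ L_c) X (1 ⊗ R_c)` over a matricial space. -/
theorem IsMatricial.kraus_le {N : MatNorm V} (hN : IsMatricial N) (L : Matrix ν (n × σ) ℂ)
    (R : Matrix (n × σ) ν ℂ) (X : Matrix (ι × n) (ι × n) V) :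
    N (ι × ν) (Matrix.of fun P Q => ∑ c, ∑ b, ∑ b', (L P.2 (b, c) * R (b', c) Q.2) •
      X (P.1, b) (Q.1, b')) ≤ opNorm L * N (ι × n) X * opNorm R := by
  have hL := opNorm_nonneg L
  have hR := opNorm_nonneg R
  refine hN.le_of_forall _ _ _ (by have := hN.nonneg _ X; positivity) fun m u hu => ?_
  -- The tensor factor `Fin m` coming from `u` is moved next to `ι`, so that the Kraus operators act
  -- on the last factor.
  let E : ∀ τ : Type, (ι × τ) × Fin m ≃ (ι × Fin m) × τ := fun τ =>
    { toFun := fun P => ((P.1.1, P.2), P.1.2)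
      invFun := fun P => ((P.1.1, P.2), P.1.2)
      left_inv := fun _ => rfl
      right_inv := fun _ => rfl }
  have h := opNorm_kraus_le L R ((ampl u X).submatrix (E n).symm (E n).symm)
  rw [opNorm_submatrix, ← opNorm_submatrix _ (E ν) (E ν)] at h
  calc _ = _ := ?_
    _ ≤ _ := h
    _ ≤ _ := by
      gcongr
      exact hu.opNorm_ampl_le X
  congr 1
  refine Matrix.ext fun P Q => ?_
  simp only [ampl, Matrix.of_apply, Matrix.submatrix_apply, map_sum, map_smul, Finset.sum_apply,
    Pi.smul_apply, smul_eq_mul]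
  refine Finset.sum_congr rfl fun c _ => Finset.sum_congr rfl fun b _ =>
    Finset.sum_congr rfl fun b' _ => ?_
  simp only [E, Equiv.coe_fn_mk, Equiv.coe_fn_symm_mk]
  ring

end Bounds

/-! ### The maps `J` and `W` at the endpoints in `p` -/

section Kraus

variable {k : ℕ} {n : Fin k → ℕ} {d m : ℕ} {S K : Fin k → Type} [∀ i, Fintype (S i)]
  [∀ i, Fintype (K i)]

/-- The map `x ↦ (c_i ∑_κ A_{sκ} x_i A_{sκ}^*)_{i,s}`. -/
def krausIn (V : Type u) [AddCommGroup V] [Module ℂ V] (e : (Σ i, S i) ≃ Fin m)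
    (A : ∀ i, S i → K i → Matrix (Fin d) (Fin (n i)) ℂ) (c : Fin k → ℂ) :
    BlockSum n V →ₗ[ℂ] MatEll d m V where
  toFun x a b j := c (e.symm j).1 • ∑ κ, ∑ p, ∑ q,
    (A _ (e.symm j).2 κ a p * star (A _ (e.symm j).2 κ b q)) • x _ p q
  map_add' x y := by
    funext a b j
    simp [Finset.sum_add_distrib]
  map_smul' z x := by
    funext a b j
    simp [Finset.smul_sum, smul_comm _ z]

/-- The map `y ↦ (c_i ∑_{s,κ} A_{sκ}^* y_{i,s} A_{sκ})_i`. -/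
def krausOut (V : Type u) [AddCommGroup V] [Module ℂ V] (e : (Σ i, S i) ≃ Fin m)
    (A : ∀ i, S i → K i → Matrix (Fin d) (Fin (n i)) ℂ) (c : Fin k → ℂ) :
    MatEll d m V →ₗ[ℂ] BlockSum n V where
  toFun y i p q := c i • ∑ s, ∑ κ, ∑ a, ∑ b,
    (star (A i s κ a p) * A i s κ b q) • y a b (e ⟨i, s⟩)
  map_add' x y := by
    funext a b j
    simp [Finset.sum_add_distrib]
  map_smul' z x := by
    funext a b j
    simp [Finset.smul_sum, smul_comm _ z]

/-- For fixed `s` the matrices `A_{sκ}` are isometries with orthogonal ranges; all together they are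
orthogonal for the Hilbert–Schmidt inner product. -/
structure IsKrausBasis [∀ i, DecidableEq (S i)] [∀ i, DecidableEq (K i)]
    (A : ∀ i, S i → K i → Matrix (Fin d) (Fin (n i)) ℂ) : Prop where
  isometry : ∀ i s κ κ' p q,
    ∑ a, star (A i s κ a p) * A i s κ' a q = if κ = κ' ∧ p = q then 1 else 0
  orthogonal : ∀ i s κ s' κ',
    ∑ a, ∑ p, star (A i s κ a p) * A i s' κ' a p = if s = s' ∧ κ = κ' then (n i : ℂ) else 0

variable [∀ i, DecidableEq (S i)] [∀ i, DecidableEq (K i)]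
  {A : ∀ i, S i → K i → Matrix (Fin d) (Fin (n i)) ℂ}

/-- The Kraus operators for fixed `s` in one row. -/
def rowMat (A : ∀ i, S i → K i → Matrix (Fin d) (Fin (n i)) ℂ) (i : Fin k) (s : S i) :
    Matrix (Fin d) (Fin (n i) × K i) ℂ :=
  Matrix.of fun a P => A i s P.2 a P.1

/-- The Kraus operators as vectors. -/
def bellMat (A : ∀ i, S i → K i → Matrix (Fin d) (Fin (n i)) ℂ) (i : Fin k) :
    Matrix (Fin d × Fin (n i)) (S i × K i) ℂ :=
  Matrix.of fun P s => A i s.1 s.2 P.1 P.2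

theorem IsKrausBasis.rowMat_mul (hA : IsKrausBasis A) (i : Fin k) (s : S i) :
    (rowMat A i s).conjTranspose * rowMat A i s = ((1 : ℝ) : ℂ) • 1 := by
  ext P Q
  rcases P with ⟨p, κ⟩
  rcases Q with ⟨q, κ'⟩
  have := hA.isometry i s κ κ' p q
  simp only [Matrix.mul_apply, Matrix.conjTranspose_apply, rowMat, Matrix.of_apply, this,
    Matrix.smul_apply, Matrix.one_apply, Prod.mk.injEq, Complex.ofReal_one, one_smul]
  simp only [and_comm]

theorem IsKrausBasis.bellMat_mul (hA : IsKrausBasis A) (i : Fin k) :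
    (bellMat A i).conjTranspose * bellMat A i = ((n i : ℝ) : ℂ) • 1 := by
  ext P Q
  have := hA.orthogonal i P.1 P.2 Q.1 Q.2
  simp only [Matrix.mul_apply, Matrix.conjTranspose_apply, bellMat, Matrix.of_apply,
    Fintype.sum_prod_type, this, Matrix.smul_apply, Matrix.one_apply, Prod.ext_iff]
  simp

theorem IsKrausBasis.opNorm_rowMat_le (hA : IsKrausBasis A) (i : Fin k) (s : S i) :
    opNorm (rowMat A i s) ≤ 1 :=
  (opNorm_le_sqrt zero_le_one (hA.rowMat_mul i s)).trans (by simp)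

theorem IsKrausBasis.opNorm_rowMat_star_le (hA : IsKrausBasis A) (i : Fin k) (s : S i) :
    opNorm ((rowMat A i s).map star) ≤ 1 :=
  (opNorm_le_sqrt zero_le_one (opNorm_conjTranspose_mul_map_star (hA.rowMat_mul i s))).trans
    (by simp)

theorem IsKrausBasis.opNorm_bellMat_le (hA : IsKrausBasis A) (i : Fin k) :
    opNorm (bellMat A i) ≤ Real.sqrt (n i) :=
  opNorm_le_sqrt (Nat.cast_nonneg _) (hA.bellMat_mul i)

theorem IsKrausBasis.opNorm_bellMat_star_le (hA : IsKrausBasis A) (i : Fin k) :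
    opNorm ((bellMat A i).map star) ≤ Real.sqrt (n i) :=
  opNorm_le_sqrt (Nat.cast_nonneg _) (opNorm_conjTranspose_mul_map_star (hA.bellMat_mul i))

/-- Two vectors of norm `√n` and a coefficient of size `1 / n`. -/
theorem scaled_bound {α β : Type} [Fintype α] [Fintype β] {L : Matrix α β ℂ} {R : Matrix β α ℂ}
    {n : ℕ} {c : ℂ} {C : ℝ} (hn : 0 < n) (hc : ‖c‖ ≤ (n : ℝ)⁻¹) (hC : 0 ≤ C)
    (hL : opNorm L ≤ Real.sqrt n) (hR : opNorm R ≤ Real.sqrt n) :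
    opNorm (c • L) * C * opNorm R ≤ C := by
  have h0 : (0 : ℝ) < n := by exact_mod_cast hn
  have h1 := opNorm_nonneg R
  have h2 := opNorm_nonneg L
  rw [opNorm_smul]
  calc ‖c‖ * opNorm L * C * opNorm R ≤ (n : ℝ)⁻¹ * Real.sqrt n * C * Real.sqrt n := by gcongr
    _ = (n : ℝ)⁻¹ * (Real.sqrt n * Real.sqrt n) * C := by ring
    _ = C := by rw [Real.mul_self_sqrt h0.le, inv_mul_cancel₀ h0.ne', one_mul]

variable {V : Type u} [NormedAddCommGroup V] [NormedSpace ℂ V] {N : MatNorm V}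
  {e : (Σ i, S i) ≃ Fin m} {c : Fin k → ℂ}

theorem minNorm_nonneg {V : Type u} {N : MatNorm V}
    (h : ∀ (ι : Type) [Fintype ι] (x : Matrix ι ι V), 0 ≤ N ι x) {n ι : Type} [Fintype n]
    [Fintype ι] (x : Matrix ι ι (n → n → V)) : 0 ≤ minNorm n N ι x := h _ _

/-- Each coordinate `(i, s)` is `c_i` times `L (x_i ⊗ 1) L^*` for the row isometry `L` formed by the
`A_{sκ}`. -/
theorem krausIn_sumInfty_le (hN : IsMatricial N) (hA : IsKrausBasis A) (hc : ∀ i, ‖c i‖ ≤ 1)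
    {ι : Type} [Fintype ι] (x : Matrix ι ι (BlockSum n V)) :
    minNorm (Fin d) (sumInftyNorm fun _ : Fin m => N) ι (x.map (krausIn V e A c)) ≤
      sumInftyNorm (fun i => minNorm (Fin (n i)) N) ι x := by
  have h0 : 0 ≤ sumInftyNorm (fun i => minNorm (Fin (n i)) N) ι x :=
    sumInftyNorm_nonneg (fun i x => minNorm_nonneg hN.nonneg x) x
  refine sumInftyNorm_le h0 fun j => ?_
  obtain ⟨⟨i, s⟩, rfl⟩ := e.surjective j
  set X : Matrix (ι × Fin (n i)) (ι × Fin (n i)) V :=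
    Matrix.of fun r s => x r.1 s.1 i r.2 s.2 with hX
  have h1 := hN.kraus_le (rowMat A i s) (rowMat A i s).conjTranspose X
  have h2 := hN.isSeminormed.smul_le _ (c i) (Matrix.of fun P Q : ι × Fin d => ∑ κ, ∑ b, ∑ b',
    (rowMat A i s P.2 (b, κ) * (rowMat A i s).conjTranspose (b', κ) Q.2) • X (P.1, b) (Q.1, b'))
  have h3 : N (ι × Fin (n i)) X ≤ sumInftyNorm (fun i => minNorm (Fin (n i)) N) ι x :=
    le_sumInftyNorm (fun i => minNorm (Fin (n i)) N) x i
  have h4 := hA.opNorm_rowMat_le i s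
  rw [opNorm_conjTranspose] at h1
  have h5 := opNorm_nonneg (rowMat A i s)
  have h6 := hN.nonneg _ X
  calc _ = _ := ?_
    _ ≤ _ := h2
    _ ≤ 1 * (1 * N (ι × Fin (n i)) X * 1) := by
      refine mul_le_mul (hc i) (h1.trans ?_) (hN.nonneg _ _) zero_le_one
      gcongr
    _ ≤ _ := by simpa using h3
  congr 1
  refine Matrix.ext fun P Q => ?_
  simp only [Matrix.of_apply, Matrix.map_apply, krausIn, LinearMap.coe_mk, AddHom.coe_mk,
    Matrix.smul_apply, rowMat, Matrix.conjTranspose_apply, hX]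
  rw [Equiv.symm_apply_apply]

/-- The component at `i` of `F ∘ krausIn`, for the map `F : ⊕_j V → M_r` given by `u_j : V → M_r`,
with values in `M_d ⊗ M_r`. -/
def krausInBlock (e : (Σ i, S i) ≃ Fin m) (A : ∀ i, S i → K i → Matrix (Fin d) (Fin (n i)) ℂ)
    (c : Fin k → ℂ) {r : Type} (u : Fin m → V →ₗ[ℂ] (r → r → ℂ)) (i : Fin k) :
    (Fin (n i) → Fin (n i) → V) →ₗ[ℂ] (Fin d × r → Fin d × r → ℂ) where
  toFun x P Q := ∑ s, c i * ∑ κ, ∑ p, ∑ q,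
    A i s κ P.1 p * star (A i s κ Q.1 q) * u (e ⟨i, s⟩) (x p q) P.2 Q.2
  map_add' x y := by
    funext P Q
    simp [Finset.sum_add_distrib, mul_add]
  map_smul' z x := by
    funext P Q
    simp only [Pi.smul_apply, map_smul, smul_eq_mul, RingHom.id_apply, Finset.mul_sum]
    refine Finset.sum_congr rfl fun s _ => Finset.sum_congr rfl fun κ _ =>
      Finset.sum_congr rfl fun p _ => Finset.sum_congr rfl fun q _ => by ring

/-- On `x ⊗ y` the value is the slice by `x` of `c_i ∑ |A_{sκ}⟩⟨A_{sκ}| ⊗ u_s(y)`. Orthogonality of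
the vectors bounds this sum by `|c_i| n_i max ‖u_s(y)‖`, and `|c_i| ≤ 1 / n_i`. -/
theorem ccMat_krausInBlock (hN : IsMatricial N) (hA : IsKrausBasis A) (hn : ∀ i, 0 < n i)
    (hc : ∀ i, ‖c i‖ ≤ (n i : ℝ)⁻¹) {r : Type} [Fintype r] {u : Fin m → V →ₗ[ℂ] (r → r → ℂ)}
    (hu : ∀ j, CCMat N (u j)) (i : Fin k) :
    CCMat (projNorm (Fin (n i)) N) (krausInBlock e A c u i) := by
  refine ccMat_projNorm (hn i) fun l μ x y => ?_
  have h := opNorm_slice_rankOne_le (r := r) x (c i • bellMat A i) (bellMat A i).conjTranspose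
    (Y := fun s => ampl (u (e ⟨i, s.1⟩)) y) (hN.nonneg _ y) fun s => (hu _).opNorm_ampl_le y
  have h1 := scaled_bound (hn i) (hc i) (hN.nonneg _ y) (hA.opNorm_bellMat_le i)
    ((opNorm_conjTranspose (bellMat A i)).le.trans (hA.opNorm_bellMat_le i))
  refine le_trans (le_of_eq ?_) (h.trans (mul_le_mul_of_nonneg_left h1 (traceNorm_nonneg x)))
  congr 1
  refine Matrix.ext fun P Q => ?_
  simp only [ampl, tmul, krausInBlock, bellMat, Matrix.of_apply, LinearMap.coe_mk, AddHom.coe_mk,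
    Matrix.smul_apply, Matrix.conjTranspose_apply, map_smul, Pi.smul_apply, smul_eq_mul,
    Fintype.sum_prod_type, Finset.mul_sum]
  rw [sum_comm_pairs]
  refine Finset.sum_congr rfl fun p _ => Finset.sum_congr rfl fun q _ =>
    Finset.sum_congr rfl fun s _ => Finset.sum_congr rfl fun κ _ => by ring

/-- Every family `u_j` testing the norm of `ℓ_1^m[V]` pulls back along `krausIn` to a family, with
values in `M_d ⊗ M_r`, testing the norm of the `ℓ_1`-sum of the blocks. -/
theorem krausIn_sumOne_le (hN : IsMatricial N) (hA : IsKrausBasis A) (hn : ∀ i, 0 < n i)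
    (hc : ∀ i, ‖c i‖ ≤ (n i : ℝ)⁻¹) {ι : Type} [Fintype ι] (x : Matrix ι ι (BlockSum n V)) :
    minNorm (Fin d) (sumOneNorm fun _ : Fin m => N) ι (x.map (krausIn V e A c)) ≤
      sumOneNorm (fun i => projNorm (Fin (n i)) N) ι x := by
  refine sumOneNorm_le (sumOneNorm_nonneg _) fun r u hu => ?_
  have h := le_sumOneNorm (fun i => ccMat_krausInBlock (e := e) hN hA hn hc hu i) x
  rw [← opNorm_submatrix _ (Equiv.prodAssoc ι (Fin d) (Fin r))
    (Equiv.prodAssoc ι (Fin d) (Fin r))] at h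
  refine le_trans (le_of_eq ?_) h
  congr 1
  refine Matrix.ext fun P Q => ?_
  simp only [ampl, Matrix.of_apply, Matrix.submatrix_apply, sumMap_apply, Equiv.prodAssoc_apply,
    krausInBlock, LinearMap.coe_mk, AddHom.coe_mk, Matrix.map_apply, krausIn]
  rw [← Equiv.sum_comp e, Fintype.sum_sigma]
  refine Finset.sum_congr rfl fun i _ => Finset.sum_congr rfl fun s _ => ?_
  rw [Equiv.symm_apply_apply]
  simp [Finset.sum_apply]

/-- After testing with `u : V → M_r` this is again a slice of a sum of rank-one terms over
orthogonal vectors. The pairing is bilinear and the variables summed are now those of `ℂ^d`, so the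
vectors are conjugated and their two indices exchanged. -/
theorem krausOut_sumInfty_le (hN : IsMatricial N) (hA : IsKrausBasis A) (hd : 0 < d)
    (hn : ∀ i, 0 < n i) (hc : ∀ i, ‖c i‖ ≤ (n i : ℝ)⁻¹) {ι : Type} [Fintype ι]
    (t : Matrix ι ι (MatEll d m V)) :
    sumInftyNorm (fun i => minNorm (Fin (n i)) N) ι (t.map (krausOut V e A c)) ≤
      projNorm (Fin d) (sumInftyNorm fun _ : Fin m => N) ι t := by
  have hinf : ∀ (μ : ℕ) (y : Matrix (Fin μ) (Fin μ) (Fin m → V)),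
      0 ≤ sumInftyNorm (fun _ : Fin m => N) (Fin μ) y := fun μ y =>
    sumInftyNorm_nonneg (fun _ => hN.nonneg _) y
  have h0 := projNorm_nonneg hinf t
  refine sumInftyNorm_le h0 fun i => hN.le_of_forall _ _ _ h0 fun r u hu => ?_
  let Φ : MatEll d m V →ₗ[ℂ] (Fin (n i) × Fin r → Fin (n i) × Fin r → ℂ) :=
    { toFun := fun y P Q => u (krausOut V e A c y i P.1 Q.1) P.2 Q.2
      map_add' := fun x y => by funext P Q; simp
      map_smul' := fun z x => by funext P Q; simp }
  have hΦ : CCMat (projNorm (Fin d) (sumInftyNorm fun _ : Fin m => N)) Φ := by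
    refine ccMat_projNorm hd fun l μ x y => ?_
    have h := opNorm_slice_rankOne_le (r := Fin r) (n := Fin d) (ν := Fin (n i)) x
      ((c i • (bellMat A i).map star).submatrix (Equiv.prodComm _ _) (Equiv.refl _))
      ((bellMat A i).transpose.submatrix (Equiv.refl _) (Equiv.prodComm _ _))
      (Y := fun s => ampl u (Matrix.of fun g h => y g h (e ⟨i, s.1⟩))) (hinf _ y)
      fun s => (hu.opNorm_ampl_le _).trans (le_sumInftyNorm (fun _ : Fin m => N) y _)
    rw [opNorm_submatrix, opNorm_submatrix] at h
    have hT : (bellMat A i).transpose = ((bellMat A i).map star).conjTranspose := by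
      ext; simp
    have h1 := scaled_bound (hn i) (hc i) (hinf _ y) (hA.opNorm_bellMat_star_le i)
      (R := (bellMat A i).transpose)
      (by rw [hT, opNorm_conjTranspose]; exact hA.opNorm_bellMat_star_le i)
    refine le_trans (le_of_eq ?_) (h.trans (mul_le_mul_of_nonneg_left h1 (traceNorm_nonneg x)))
    congr 1
    refine Matrix.ext fun P Q => ?_
    simp only [ampl, tmul, Φ, krausOut, bellMat, Matrix.of_apply, LinearMap.coe_mk, AddHom.coe_mk,
      map_smul, Pi.smul_apply, smul_eq_mul, map_sum,
      Fintype.sum_prod_type, Finset.mul_sum, Finset.sum_apply]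
    rw [sum_comm_pairs]
    refine Finset.sum_congr rfl fun a _ => Finset.sum_congr rfl fun b _ =>
      Finset.sum_congr rfl fun s _ => Finset.sum_congr rfl fun κ _ => ?_
    simp only [Matrix.submatrix_apply, Equiv.prodComm_apply, Prod.swap_prod_mk, Equiv.refl_apply,
      Matrix.smul_apply, Matrix.map_apply, Matrix.transpose_apply, Matrix.of_apply, smul_eq_mul]
    ring
  have h1 := hΦ.opNorm_ampl_le t
  rw [← opNorm_submatrix _ (Equiv.prodAssoc ι (Fin (n i)) (Fin r))
    (Equiv.prodAssoc ι (Fin (n i)) (Fin r))] at h1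
  exact h1

/-- The map `v ↦ E_{pq} ⊗ v`. -/
def unitMap {n : ℕ} (p q : Fin n) : V →ₗ[ℂ] (Fin n → Fin n → V) where
  toFun v a b := unitElement (Fin n) p q a b • v
  map_add' v w := by
    funext a b
    simp
  map_smul' z v := by
    funext a b
    simp [smul_comm z]

/-- The component at `j` of the map `⊕_j V → M_r ⊗ M_d` dual to `φ ∘ krausOut`. -/
def krausOutBlock (e : (Σ i, S i) ≃ Fin m) (A : ∀ i, S i → K i → Matrix (Fin d) (Fin (n i)) ℂ)
    (c : Fin k → ℂ) {r : Type} (φ : ∀ i, (Fin (n i) → Fin (n i) → V) →ₗ[ℂ] (r → r → ℂ))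
    (j : Fin m) : V →ₗ[ℂ] (r × Fin d → r × Fin d → ℂ) where
  toFun v P Q := c (e.symm j).1 * ∑ κ, ∑ p, ∑ q,
    star (A _ (e.symm j).2 κ P.2 p) * A _ (e.symm j).2 κ Q.2 q * φ _ (unitMap p q v) P.1 Q.1
  map_add' v w := by
    funext P Q
    simp [Finset.sum_add_distrib, mul_add]
  map_smul' z v := by
    funext P Q
    simp only [Pi.smul_apply, map_smul, smul_eq_mul, RingHom.id_apply, Finset.mul_sum]
    refine Finset.sum_congr rfl fun κ _ =>
      Finset.sum_congr rfl fun p _ => Finset.sum_congr rfl fun q _ => by ring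

/-- The matrix of all `φ_i(E_{pq} ⊗ v)` is `φ_i` applied to the unit element tensored with `v`,
whose projective norm is at most that of `v`. The remaining sum over `κ` is multiplication by a row
isometry and its adjoint. -/
theorem ccMat_krausOutBlock (hN : IsMatricial N) (hA : IsKrausBasis A) (hc : ∀ i, ‖c i‖ ≤ 1)
    {r : Type} [Fintype r] {φ : ∀ i, (Fin (n i) → Fin (n i) → V) →ₗ[ℂ] (r → r → ℂ)}
    (hφ : ∀ i, CCMat (projNorm (Fin (n i)) N) (φ i)) (j : Fin m) :
    CCMat N (krausOutBlock e A c φ j) := by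
  refine ccMat_of_forall fun μ _ y => ?_
  obtain ⟨⟨i, s⟩, rfl⟩ := e.surjective j
  have h0 := hN.nonneg μ y
  have hX := ((hφ i).opNorm_ampl_le (tmul (unitElement (Fin (n i))) y)).trans
    (projNorm_tmul_unitElement_le (fun _ => hN.nonneg _) hN.isRelabelInvariant y h0)
  let E : (μ × r) × Fin (n i) ≃ (Fin (n i) × μ) × r :=
    { toFun := fun P => ((P.2, P.1.1), P.1.2)
      invFun := fun P => ((P.1.2, P.2), P.1.1)
      left_inv := fun _ => rfl
      right_inv := fun _ => rfl }
  have h := opNorm_kraus_le ((rowMat A i s).map star) (rowMat A i s).transpose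
    ((ampl (φ i) (tmul (unitElement (Fin (n i))) y)).submatrix E E)
  have hT : (rowMat A i s).transpose = ((rowMat A i s).map star).conjTranspose := by
    ext; simp
  rw [opNorm_submatrix, ← opNorm_submatrix _ (Equiv.prodAssoc μ r (Fin d)).symm
    (Equiv.prodAssoc μ r (Fin d)).symm, hT, opNorm_conjTranspose] at h
  have h1 := hA.opNorm_rowMat_star_le i s
  have h2 := opNorm_nonneg ((rowMat A i s).map star)
  have h3 := opNorm_nonneg (ampl (φ i) (tmul (unitElement (Fin (n i))) y))
  have h4 := h.trans (mul_le_mul (mul_le_mul h1 hX h3 zero_le_one) h1 h2 (by linarith))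
  rw [one_mul, mul_one] at h4
  have h5 := opNorm_nonneg (Matrix.submatrix (Matrix.of fun (P Q : (μ × r) × Fin d) =>
    ∑ κ, ∑ b, ∑ b', (rowMat A i s).map star P.2 (b, κ) *
      (ampl (φ i) (tmul (unitElement (Fin (n i))) y)).submatrix E E (P.1, b) (Q.1, b') *
      ((rowMat A i s).map star).conjTranspose (b', κ) Q.2) (Equiv.prodAssoc μ r (Fin d)).symm
        (Equiv.prodAssoc μ r (Fin d)).symm)
  have h6 := mul_le_mul (hc i) h4 h5 zero_le_one
  rw [← opNorm_smul, one_mul] at h6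
  refine le_trans (le_of_eq ?_) h6
  congr 1
  refine Matrix.ext fun P Q => ?_
  simp only [ampl, krausOutBlock, Matrix.of_apply, Matrix.smul_apply, Matrix.submatrix_apply,
    LinearMap.coe_mk, AddHom.coe_mk, smul_eq_mul, E, Equiv.coe_fn_mk, tmul, rowMat,
    Equiv.prodAssoc_symm_apply, Matrix.map_apply, Matrix.conjTranspose_apply, star_star]
  rw [Equiv.symm_apply_apply]
  congr 1
  refine Finset.sum_congr rfl fun κ _ =>
    Finset.sum_congr rfl fun p _ => Finset.sum_congr rfl fun q _ => ?_
  rw [mul_right_comm]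
  rfl

theorem apply_eq_sum_unitElement {n : ℕ} {r : Type}
    (φ : (Fin n → Fin n → V) →ₗ[ℂ] (r → r → ℂ)) (f : Fin n → Fin n → V) :
    φ f = ∑ p, ∑ q, φ (unitMap p q (f p q)) := by
  simp only [← map_sum]
  congr 1
  funext a b
  simp [Finset.sum_apply, unitMap, unitElement, ite_smul]

/-- For a test family `φ`, the value of `φ ∘ krausOut` on `x ⊗ y` is the slice by `x` of the image
of `y` under the maps `krausOutBlock`, and these form a test family for `ℓ_1^m[V]`. -/
theorem krausOut_sumOne_le (hN : IsMatricial N) (hA : IsKrausBasis A) (hd : 0 < d)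
    (hc : ∀ i, ‖c i‖ ≤ 1) {ι : Type} [Fintype ι] (t : Matrix ι ι (MatEll d m V)) :
    sumOneNorm (fun i => projNorm (Fin (n i)) N) ι (t.map (krausOut V e A c)) ≤
      projNorm (Fin d) (sumOneNorm fun _ : Fin m => N) ι t := by
  have hone : ∀ (μ : ℕ) (y : Matrix (Fin μ) (Fin μ) (Fin m → V)),
      0 ≤ sumOneNorm (fun _ : Fin m => N) (Fin μ) y := fun μ y => sumOneNorm_nonneg y
  refine sumOneNorm_le (projNorm_nonneg hone t) fun r φ hφ => ?_
  have hΦ : CCMat (projNorm (Fin d) (sumOneNorm fun _ : Fin m => N))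
      (sumMap φ ∘ₗ krausOut V e A c) := by
    refine ccMat_projNorm hd fun l μ x y => ?_
    have h1 := le_sumOneNorm (fun j => ccMat_krausOutBlock (e := e) hN hA hc hφ j) y
    let E₁ := Equiv.prodAssoc (Fin μ) (Fin r) (Fin d)
    have h2 := opNorm_slice_le x ((ampl (sumMap (krausOutBlock e A c φ)) y).submatrix E₁ E₁)
    let E : (Fin l × Fin μ) × Fin r ≃ (Fin μ × Fin r) × Fin l :=
      { toFun := fun P => ((P.1.2, P.2), P.1.1)
        invFun := fun P => ((P.2, P.1.1), P.1.2)
        left_inv := fun _ => rfl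
        right_inv := fun _ => rfl }
    rw [opNorm_submatrix, ← opNorm_submatrix _ E E] at h2
    refine le_trans (le_of_eq ?_) (h2.trans (mul_le_mul_of_nonneg_left h1 (traceNorm_nonneg x)))
    congr 1
    refine Matrix.ext fun P Q => ?_
    simp only [ampl, slice, tmul, Matrix.of_apply, Matrix.submatrix_apply, LinearMap.comp_apply,
      sumMap_apply, E, E₁, Equiv.coe_fn_mk, Equiv.prodAssoc_apply, Finset.mul_sum]
    -- What remains is to match two finite sums: `φ_i` is expanded over matrix units and the
    -- summations are put into the same order.
    simp_rw [← Equiv.sum_comp e, Fintype.sum_sigma]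
    rw [sum_comm_triple]
    refine Finset.sum_congr rfl fun i _ => ?_
    rw [sum_comm_triple]
    rw [apply_eq_sum_unitElement (φ i)]
    simp only [krausOut, krausOutBlock, LinearMap.coe_mk, AddHom.coe_mk, map_smul, map_sum,
      Finset.sum_apply, Pi.smul_apply, smul_eq_mul, Finset.mul_sum]
    rw [sum_comm_pairs]
    refine Finset.sum_congr rfl fun s _ => ?_
    symm
    rw [Equiv.symm_apply_apply, sum_comm_triple]
    refine Finset.sum_congr rfl fun κ _ => ?_
    symm
    rw [sum_comm_pairs]
    refine Finset.sum_congr rfl fun a _ => Finset.sum_congr rfl fun b _ =>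
      Finset.sum_congr rfl fun p _ => Finset.sum_congr rfl fun q _ => by ring
  exact hΦ.opNorm_ampl_le t

end Kraus
-- Bounded analytic functions on the strip
section Strip

/-- Bounded continuous functions on the closed strip that are analytic inside. -/
def BddHol {X : Type*} [NormedAddCommGroup X] [NormedSpace ℂ X] (f : ℂ → X) : Prop :=
  DiffContOnCl ℂ f {z : ℂ | 0 < z.re ∧ z.re < 1} ∧
  ∃ B : ℝ, ∀ z : ℂ, 0 ≤ z.re → z.re ≤ 1 → ‖f z‖ ≤ B

variable {X Y : Type*} [NormedAddCommGroup X] [NormedSpace ℂ X] [NormedAddCommGroup Y]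
  [NormedSpace ℂ Y]

theorem bddHol_const (x : X) : BddHol fun _ => x :=
  ⟨diffContOnCl_const, ‖x‖, fun _ _ _ => le_rfl⟩

theorem BddHol.add {f g : ℂ → X} (hf : BddHol f) (hg : BddHol g) : BddHol fun z => f z + g z := by
  obtain ⟨h1, B, hB⟩ := hf
  obtain ⟨h2, B', hB'⟩ := hg
  exact ⟨h1.add h2, B + B', fun z h0 h1 =>
    (norm_add_le _ _).trans (add_le_add (hB z h0 h1) (hB' z h0 h1))⟩

theorem BddHol.smul {c : ℂ → ℂ} {f : ℂ → X} (hc : BddHol c) (hf : BddHol f) :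
    BddHol fun z => c z • f z := by
  obtain ⟨h1, B, hB⟩ := hc
  obtain ⟨h2, B', hB'⟩ := hf
  refine ⟨h1.smul h2, |B| * |B'|, fun z h0 h1 => ?_⟩
  rw [norm_smul]
  gcongr
  · exact (hB z h0 h1).trans (le_abs_self B)
  · exact (hB' z h0 h1).trans (le_abs_self B')

theorem BddHol.sum {τ : Type*} (s : Finset τ) {f : τ → ℂ → X} (hf : ∀ i ∈ s, BddHol (f i)) :
    BddHol fun z => ∑ i ∈ s, f i z := by
  classical
  induction s using Finset.induction_on with
  | empty => simpa using bddHol_const (0 : X)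
  | insert a s ha ih =>
    simp only [Finset.sum_insert ha]
    exact (hf a (Finset.mem_insert_self a s)).add
      (ih fun i hi => hf i (Finset.mem_insert_of_mem hi))

theorem BddHol.clm (L : X →L[ℂ] Y) {f : ℂ → X} (hf : BddHol f) : BddHol fun z => L (f z) := by
  obtain ⟨h1, B, hB⟩ := hf
  refine ⟨L.differentiable.comp_diffContOnCl h1, ‖L‖ * B, fun z h0 h1 => ?_⟩
  exact (L.le_opNorm _).trans (by gcongr; exact hB z h0 h1)

theorem BddHol.apply {τ : Type*} [Fintype τ] {X : τ → Type*} [∀ i, NormedAddCommGroup (X i)]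
    [∀ i, NormedSpace ℂ (X i)] {f : ℂ → ∀ i, X i} (hf : BddHol f) (i : τ) :
    BddHol fun z => f z i := hf.clm (ContinuousLinearMap.proj i)

theorem bddHol_pi {τ : Type*} [Fintype τ] {X : τ → Type*} [∀ i, NormedAddCommGroup (X i)]
    [∀ i, NormedSpace ℂ (X i)] {f : ℂ → ∀ i, X i} (hf : ∀ i, BddHol fun z => f z i) :
    BddHol f := by
  refine ⟨⟨differentiableOn_pi.2 fun i => (hf i).1.1, continuousOn_pi.2 fun i => (hf i).1.2⟩, ?_⟩
  choose B hB using fun i => (hf i).2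
  refine ⟨∑ i, |B i|, fun z h0 h1 => ?_⟩
  refine (pi_norm_le_iff_of_nonneg (Finset.sum_nonneg fun _ _ => abs_nonneg _)).2 fun i => ?_
  exact ((hB i z h0 h1).trans (le_abs_self _)).trans
    (Finset.single_le_sum (f := fun i => |B i|) (fun _ _ => abs_nonneg _) (Finset.mem_univ i))

theorem norm_natCast_cpow {n : ℕ} (hn : 0 < n) (w : ℂ) : ‖(n : ℂ) ^ w‖ = (n : ℝ) ^ w.re := by
  rw [← Complex.ofReal_natCast, Complex.norm_cpow_eq_rpow_re_of_pos (by exact_mod_cast hn)]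

theorem bddHol_natCast_cpow {n : ℕ} (hn : 0 < n) {g : ℂ → ℂ} (hg : Differentiable ℂ g)
    (hre : ∀ z : ℂ, 0 ≤ z.re → z.re ≤ 1 → (g z).re ≤ 0) : BddHol fun z => (n : ℂ) ^ g z := by
  have h0 : (n : ℂ) ≠ 0 := by exact_mod_cast hn.ne'
  refine ⟨(hg.const_cpow (Or.inl h0)).diffContOnCl, 1, fun z h1 h2 => ?_⟩
  rw [norm_natCast_cpow hn]
  exact Real.rpow_le_one_of_one_le_of_nonpos (by exact_mod_cast hn) (hre z h1 h2)

/-- The three lines theorem for a bounded analytic function and a continuous seminorm. -/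
theorem BddHol.seminorm_le {f : ℂ → X} (hf : BddHol f) {p : Seminorm ℂ X} (hp : Continuous p)
    {C : ℝ} (h0 : ∀ t : ℝ, p (f (t * Complex.I)) ≤ C) (h1 : ∀ t : ℝ, p (f (1 + t * Complex.I)) ≤ C)
    {θ : ℝ} (hθ0 : 0 ≤ θ) (hθ1 : θ ≤ 1) : p (f θ) ≤ C := by
  -- Hahn–Banach: a functional dominated by `p` and attaining it at `f θ` reduces the claim to
  -- scalar functions.
  obtain ⟨L, hL, hLp⟩ : ∃ L : X →L[ℂ] ℂ, ‖L (f θ)‖ = p (f θ) ∧ ∀ x, ‖L x‖ ≤ p x := by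
    by_cases hx : f θ = 0
    · exact ⟨0, by simp [hx], fun x => by simp⟩
    let S : Submodule ℂ X := Submodule.span ℂ {f θ}
    let l : S →ₗ[ℂ] ℂ :=
      ((p (f θ) : ℂ)) • (LinearEquiv.toSpanNonzeroSingleton ℂ X (f θ) hx).symm.toLinearMap
    have hl : ∀ c : ℂ, ∀ h : c • f θ ∈ S, l ⟨c • f θ, h⟩ = p (f θ) * c := by
      intro c h
      have : (LinearEquiv.toSpanNonzeroSingleton ℂ X (f θ) hx).symm ⟨c • f θ, h⟩ = c := by
        rw [LinearEquiv.symm_apply_eq]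
        rfl
      simp only [l, LinearMap.smul_apply, LinearEquiv.coe_coe, this, smul_eq_mul]
    have hle : ∀ x : S, ‖l x‖ ≤ p x := by
      rintro ⟨x, hx'⟩
      obtain ⟨c, rfl⟩ := Submodule.mem_span_singleton.1 hx'
      rw [hl, norm_mul, Complex.norm_real, Real.norm_of_nonneg (apply_nonneg p _), map_smul_eq_mul,
        mul_comm]
    obtain ⟨L, hL, hLp⟩ := Module.Dual.exists_continuous_extension_of_le_seminorm S l hp hle
    refine ⟨L, ?_, hLp⟩
    have := hL ⟨(1 : ℂ) • f θ, Submodule.smul_mem _ _ (Submodule.mem_span_singleton_self _)⟩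
    rw [hl] at this
    simp only [one_smul, mul_one] at this
    rw [this, Complex.norm_real, Real.norm_of_nonneg (apply_nonneg p _)]
  rw [← hL]
  have hs : {z : ℂ | 0 < z.re ∧ z.re < 1} = Complex.re ⁻¹' Set.Ioo 0 1 := rfl
  obtain ⟨hd, B, hB⟩ := hf.clm L
  rw [hs] at hd
  refine PhragmenLindelof.vertical_strip hd ?_ (fun z hz => ?_) (fun z hz => ?_)
    (by simpa using hθ0) (by simpa using hθ1)
  -- The growth condition of Phragmén–Lindelöf, trivially satisfied by a bounded function.
  · refine ⟨0, by simpa using Real.pi_pos, 0, ?_⟩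
    refine Asymptotics.IsBigO.of_bound B ?_
    refine Filter.eventually_inf_principal.2 (Filter.Eventually.of_forall fun z hz => ?_)
    simpa using hB z hz.1.le hz.2.le
  · have : z = z.im * Complex.I := by apply Complex.ext <;> simp [hz]
    rw [this]
    exact (hLp _).trans (h0 _)
  · have : z = 1 + z.im * Complex.I := by apply Complex.ext <;> simp [hz]
    rw [this]
    exact (hLp _).trans (h1 _)

end Strip

/-! ### Complex interpolation of matrix norms -/

section Interp

variable {V : Type u} [NormedAddCommGroup V] [NormedSpace ℂ V] {N₀ N₁ : MatNorm V} {θ : ℝ}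
  {ι : Type} [Fintype ι]

theorem isAdmissible_iff {f : ℂ → ι → ι → V} {C : ℝ} : IsAdmissible N₀ N₁ ι f C ↔ BddHol f ∧
    (∀ t : ℝ, N₀ ι (Matrix.of (f (t * Complex.I))) ≤ C) ∧
    (∀ t : ℝ, N₁ ι (Matrix.of (f (1 + t * Complex.I))) ≤ C) := by
  unfold IsAdmissible BddHol
  rw [and_assoc]

theorem interp_le (h0 : ∀ x : Matrix ι ι V, 0 ≤ N₀ ι x) {f : ℂ → ι → ι → V} {C : ℝ}
    (hf : IsAdmissible N₀ N₁ ι f C) {x : Matrix ι ι V} (hx : Matrix.of (f θ) = x) :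
    interp θ N₀ N₁ ι x ≤ C := by
  refine csInf_le ⟨0, ?_⟩ ⟨f, hf, hx⟩
  rintro c ⟨g, hg, -⟩
  exact (h0 _).trans (hg.2.2.1 0)

theorem isAdmissible_const (x : Matrix ι ι V) :
    IsAdmissible N₀ N₁ ι (fun _ => x) (max (N₀ ι x) (N₁ ι x)) :=
  isAdmissible_iff.2 ⟨bddHol_const (X := ι → ι → V) x, fun _ => le_max_left _ _,
    fun _ => le_max_right _ _⟩

/-- Constant functions are admissible, so the infimum is over a nonempty set and may be bounded
below function by function. -/
theorem le_interp {x : Matrix ι ι V} {c : ℝ} (h : ∀ (f : ℂ → ι → ι → V) (C : ℝ),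
    IsAdmissible N₀ N₁ ι f C → Matrix.of (f θ) = x → c ≤ C) : c ≤ interp θ N₀ N₁ ι x := by
  refine le_csInf ⟨_, fun _ => x, isAdmissible_const x, rfl⟩ ?_
  rintro C ⟨f, hf, hx⟩
  exact h f C hf hx

theorem interp_le_max (h0 : ∀ x : Matrix ι ι V, 0 ≤ N₀ ι x) (x : Matrix ι ι V) :
    interp θ N₀ N₁ ι x ≤ max (N₀ ι x) (N₁ ι x) :=
  interp_le h0 (isAdmissible_const x) rfl

theorem interp_nonneg (h0 : ∀ x : Matrix ι ι V, 0 ≤ N₀ ι x) (x : Matrix ι ι V) :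
    0 ≤ interp θ N₀ N₁ ι x :=
  le_interp fun f _ hf _ => (h0 (Matrix.of (f _))).trans (hf.2.2.1 0)

theorem isRelabelInvariant_interp (hn : ∀ (ι : Type) [Fintype ι] (x : Matrix ι ι V), 0 ≤ N₀ ι x)
    (h0 : IsRelabelInvariant N₀) (h1 : IsRelabelInvariant N₁) :
    IsRelabelInvariant (interp θ N₀ N₁) := by
  refine isRelabelInvariant_of_le fun ι ι' _ _ e x => le_interp fun f C hf hx => ?_
  rw [isAdmissible_iff] at hf
  refine interp_le (hn ι') (f := fun z r s => f z (e r) (e s)) (isAdmissible_iff.2 ⟨?_, ?_, ?_⟩) ?_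
  · exact bddHol_pi fun r => bddHol_pi fun s => (hf.1.apply (e r)).apply (e s)
  · exact fun t => (h0 ι ι' e (Matrix.of (f (t * Complex.I)))).le.trans (hf.2.1 t)
  · exact fun t => (h1 ι ι' e (Matrix.of (f (1 + t * Complex.I)))).le.trans (hf.2.2 t)
  · rw [← hx]
    rfl

theorem IsSeminormed.interp (h0 : IsSeminormed N₀) (h1 : IsSeminormed N₁) :
    IsSeminormed (interp θ N₀ N₁) where
  nonneg ι _ x := interp_nonneg (h0.nonneg ι) x
  add_le ι _ x y := by
    rw [← sub_le_iff_le_add]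
    refine le_interp fun f C hf hx => ?_
    rw [sub_le_comm]
    refine le_interp fun g D hg hy => ?_
    rw [isAdmissible_iff] at hf hg
    rw [sub_le_iff_le_add']
    refine interp_le (h0.nonneg ι) (f := fun z => f z + g z)
      (isAdmissible_iff.2 ⟨hf.1.add hg.1, ?_, ?_⟩) ?_
    · exact fun t => (h0.add_le ι (Matrix.of (f _)) (Matrix.of (g _))).trans
        (add_le_add (hf.2.1 t) (hg.2.1 t))
    · exact fun t => (h1.add_le ι (Matrix.of (f _)) (Matrix.of (g _))).trans
        (add_le_add (hf.2.2 t) (hg.2.2 t))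
    · rw [← hx, ← hy]
      rfl
  smul_le ι _ c x := by
    -- For `c ≠ 0` the inequality is divided by `‖c‖`; for `c = 0` the constant function `0`
    -- suffices.
    rcases eq_or_ne c 0 with rfl | hc
    · have hz : N₀ ι ((0 : ℂ) • x) ≤ 0 := by simpa using h0.smul_le ι 0 x
      have hz' : N₁ ι ((0 : ℂ) • x) ≤ 0 := by simpa using h1.smul_le ι 0 x
      exact (interp_le_max (h0.nonneg ι) _).trans ((max_le hz hz').trans (by simp))
    have hc' : 0 < ‖c‖ := norm_pos_iff.2 hc
    rw [← div_le_iff₀' hc']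
    refine le_interp fun f C hf hx => ?_
    rw [div_le_iff₀' hc']
    rw [isAdmissible_iff] at hf
    refine interp_le (h0.nonneg ι) (f := fun z => c • f z)
      (isAdmissible_iff.2 ⟨(bddHol_const c).smul hf.1, ?_, ?_⟩) ?_
    · exact fun t => (h0.smul_le ι c (Matrix.of (f _))).trans
        (mul_le_mul_of_nonneg_left (hf.2.1 t) hc'.le)
    · exact fun t => (h1.smul_le ι c (Matrix.of (f _))).trans
        (mul_le_mul_of_nonneg_left (hf.2.2 t) hc'.le)
    · rw [← hx]
      rfl
  le_sum := by
    obtain ⟨K, hK, h⟩ := h0.le_sum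
    obtain ⟨K', hK', h'⟩ := h1.le_sum
    refine ⟨max K K', le_max_of_le_left hK, fun ι _ x => ?_⟩
    have hs : 0 ≤ ∑ r, ∑ s, ‖x r s‖ :=
      Finset.sum_nonneg fun _ _ => Finset.sum_nonneg fun _ _ => norm_nonneg _
    refine (interp_le_max (h0.nonneg ι) x).trans (max_le ?_ ?_)
    · exact (h ι x).trans (mul_le_mul_of_nonneg_right (le_max_left _ _) hs)
    · exact (h' ι x).trans (mul_le_mul_of_nonneg_right (le_max_right _ _) hs)

/-- The three lines theorem for functions with values in matrices over a seminormed space. -/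
theorem IsSeminormed.le_of_boundary {N : MatNorm V} (hN : IsSeminormed N) {f : ℂ → ι → ι → V}
    (hf : BddHol f) {C : ℝ} (h0 : ∀ t : ℝ, N ι (Matrix.of (f (t * Complex.I))) ≤ C)
    (h1 : ∀ t : ℝ, N ι (Matrix.of (f (1 + t * Complex.I))) ≤ C) (hθ0 : 0 ≤ θ) (hθ1 : θ ≤ 1) :
    N ι (Matrix.of (f θ)) ≤ C := by
  let p : Seminorm ℂ (ι → ι → V) := Seminorm.ofSMulLE (fun x => N ι (Matrix.of x))
    (le_antisymm (by simpa using hN.smul_le ι 0 0) (hN.nonneg ι _))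
    (fun x y => hN.add_le ι (Matrix.of x) (Matrix.of y)) (fun c x => hN.smul_le ι c (Matrix.of x))
  have hp : Continuous p := by
    obtain ⟨K, hK, h⟩ := hN.le_sum
    refine Seminorm.continuous_of_continuousAt_zero ?_
    have hlim : Filter.Tendsto (fun x : ι → ι → V => K * ∑ r, ∑ s, ‖x r s‖) (nhds 0) (nhds 0) := by
      have : Continuous fun x : ι → ι → V => K * ∑ r, ∑ s, ‖x r s‖ := by fun_prop
      simpa using this.tendsto 0
    unfold ContinuousAt
    rw [map_zero]
    exact squeeze_zero (fun x => apply_nonneg p x) (fun x => h ι (Matrix.of x)) hlim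
  exact hf.seminorm_le hp h0 h1 hθ0 hθ1

theorem le_mul_interp {x : Matrix ι ι V} {K c : ℝ} (hK : 0 ≤ K) (h : ∀ (f : ℂ → ι → ι → V) (C : ℝ),
    IsAdmissible N₀ N₁ ι f C → Matrix.of (f θ) = x → c ≤ K * C) :
    c ≤ K * OpSpace.interp θ N₀ N₁ ι x := by
  rcases hK.eq_or_lt with rfl | hK
  · simpa using h _ _ (isAdmissible_const x) rfl
  · rw [← div_le_iff₀' hK]
    exact le_interp fun f C hf hx => (div_le_iff₀' hK).2 (h f C hf hx)

end Interp
-- Seminorm properties of the spaces involved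
section Seminormed

variable {V : Type u} [NormedAddCommGroup V] [NormedSpace ℂ V] {N : MatNorm V} {k : ℕ}
  {n : Fin k → ℕ}

theorem sum_norm_entries_le {a : ℕ} {ι : Type} [Fintype ι] (x : Matrix ι ι (Fin a → Fin a → V)) :
    ∑ P : ι × Fin a, ∑ Q : ι × Fin a, ‖x P.1 Q.1 P.2 Q.2‖ ≤ (a : ℝ) ^ 2 * ∑ r, ∑ s, ‖x r s‖ := by
  simp only [Fintype.sum_prod_type, Finset.mul_sum]
  refine Finset.sum_le_sum fun r _ => ?_
  rw [Finset.sum_comm]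
  refine Finset.sum_le_sum fun s _ => ?_
  calc ∑ p, ∑ q, ‖x r s p q‖ ≤ ∑ _p : Fin a, ∑ _q : Fin a, ‖x r s‖ :=
        Finset.sum_le_sum fun p _ => Finset.sum_le_sum fun q _ =>
          (norm_le_pi_norm (x r s p) q).trans (norm_le_pi_norm (x r s) p)
    _ = _ := by simp; ring

theorem sum_norm_comp_le {κ : Type} [Fintype κ] {X : κ → Type u} [∀ i, NormedAddCommGroup (X i)]
    {ι : Type} [Fintype ι] (x : Matrix ι ι (∀ i, X i)) (i : κ) :
    ∑ r, ∑ s, ‖x r s i‖ ≤ ∑ r, ∑ s, ‖x r s‖ :=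
  Finset.sum_le_sum fun r _ => Finset.sum_le_sum fun s _ => norm_le_pi_norm (x r s) i

theorem isSeminormed_sumInfty_minNorm (hN : IsMatricial N) :
    IsSeminormed (sumInftyNorm fun i => minNorm (Fin (n i)) N : MatNorm (BlockSum n V)) where
  nonneg ι _ x := sumInftyNorm_nonneg (fun i x => minNorm_nonneg hN.nonneg x) x
  add_le ι _ x y := by
    refine sumInftyNorm_le (add_nonneg
      (sumInftyNorm_nonneg (fun i x => minNorm_nonneg hN.nonneg x) x)
      (sumInftyNorm_nonneg (fun i x => minNorm_nonneg hN.nonneg x) y)) fun i => ?_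
    exact (hN.isSeminormed.add_le (ι × Fin (n i)) (Matrix.of fun P Q => x P.1 Q.1 i P.2 Q.2)
      (Matrix.of fun P Q => y P.1 Q.1 i P.2 Q.2)).trans
      (add_le_add (le_sumInftyNorm (fun i => minNorm (Fin (n i)) N) x i)
        (le_sumInftyNorm (fun i => minNorm (Fin (n i)) N) y i))
  smul_le ι _ c x := by
    refine sumInftyNorm_le (mul_nonneg (norm_nonneg _)
      (sumInftyNorm_nonneg (fun i x => minNorm_nonneg hN.nonneg x) x)) fun i => ?_
    exact (hN.isSeminormed.smul_le (ι × Fin (n i)) c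
      (Matrix.of fun P Q => x P.1 Q.1 i P.2 Q.2)).trans
      (mul_le_mul_of_nonneg_left (le_sumInftyNorm (fun i => minNorm (Fin (n i)) N) x i)
        (norm_nonneg _))
  le_sum := by
    have h0 : ∀ i ∈ Finset.univ, 0 ≤ (n i : ℝ) ^ 2 := fun _ _ => sq_nonneg _
    refine ⟨∑ i, (n i : ℝ) ^ 2, Finset.sum_nonneg h0, fun ι _ x => ?_⟩
    have hs : 0 ≤ ∑ r, ∑ s, ‖x r s‖ :=
      Finset.sum_nonneg fun _ _ => Finset.sum_nonneg fun _ _ => norm_nonneg _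
    refine sumInftyNorm_le (mul_nonneg (Finset.sum_nonneg h0) hs) fun i => ?_
    refine (hN.le_sum (ι × Fin (n i)) (Matrix.of fun P Q => x P.1 Q.1 i P.2 Q.2)).trans ?_
    refine (sum_norm_entries_le (Matrix.of fun r s => x r s i)).trans ?_
    exact mul_le_mul (Finset.single_le_sum h0 (Finset.mem_univ i)) (sum_norm_comp_le x i)
      (Finset.sum_nonneg fun _ _ => Finset.sum_nonneg fun _ _ => norm_nonneg _)
      (Finset.sum_nonneg h0)

theorem sumOneNorm_le_sum {κ : Type} [Fintype κ] {X : κ → Type u} [∀ i, AddCommGroup (X i)]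
    [∀ i, Module ℂ (X i)] {M : ∀ i, MatNorm (X i)} {ι : Type} [Fintype ι]
    (hM : ∀ i (x : Matrix ι ι (X i)), 0 ≤ M i ι x) (x : Matrix ι ι (∀ i, X i)) :
    sumOneNorm M ι x ≤ ∑ i, M i ι (Matrix.of fun r s => x r s i) :=
  sumOneNorm_le (Finset.sum_nonneg fun i _ => hM i _)
    fun _ _ hφ => opNorm_ampl_sumMap_le_sum hφ x

theorem isSeminormed_sumOne_projNorm (hN : IsMatricial N) (hn : ∀ i, 0 < n i) :
    IsSeminormed (sumOneNorm fun i => projNorm (Fin (n i)) N : MatNorm (BlockSum n V)) where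
  nonneg ι _ x := sumOneNorm_nonneg x
  add_le ι _ x y := by
    refine sumOneNorm_le (add_nonneg (sumOneNorm_nonneg x) (sumOneNorm_nonneg y)) fun m φ hφ => ?_
    rw [ampl_add]
    exact (opNorm_add_le _ _).trans (add_le_add (le_sumOneNorm hφ x) (le_sumOneNorm hφ y))
  smul_le ι _ c x := by
    refine sumOneNorm_le (mul_nonneg (norm_nonneg _) (sumOneNorm_nonneg x)) fun m φ hφ => ?_
    rw [ampl_smul, opNorm_smul]
    exact mul_le_mul_of_nonneg_left (le_sumOneNorm hφ x) (norm_nonneg _)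
  le_sum := by
    -- One factor `n_i` compares the projective norm with the minimal one; `n_i ^ 2` counts the
    -- entries of a block.
    refine ⟨∑ i, (n i : ℝ) * (n i : ℝ) ^ 2, by positivity, fun ι _ x => ?_⟩
    refine (sumOneNorm_le_sum (fun i x => projNorm_nonneg (fun _ => hN.nonneg _) x) x).trans ?_
    rw [Finset.sum_mul]
    refine Finset.sum_le_sum fun i _ => ?_
    refine (projNorm_le_minNorm (hn i) (fun _ => hN.nonneg _) hN.isRelabelInvariant
      (hN.nonneg _) _).trans ?_
    refine (hN.isSeminormed.smul_le (ι × Fin (n i)) (n i : ℂ)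
      (Matrix.of fun P Q => x P.1 Q.1 i P.2 Q.2)).trans ?_
    rw [Complex.norm_natCast, mul_assoc]
    refine mul_le_mul_of_nonneg_left ?_ (Nat.cast_nonneg _)
    refine (hN.le_sum (ι × Fin (n i)) (Matrix.of fun P Q => x P.1 Q.1 i P.2 Q.2)).trans ?_
    refine (sum_norm_entries_le (Matrix.of fun r s => x r s i)).trans ?_
    exact mul_le_mul_of_nonneg_left (sum_norm_comp_le x i) (sq_nonneg _)

theorem isSeminormed_schattenSumNorm (hN : IsMatricial N) (hn : ∀ i, 0 < n i) (p : ℝ≥0∞) :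
    IsSeminormed (schattenSumNorm p n N) :=
  (isSeminormed_sumInfty_minNorm hN).interp (isSeminormed_sumOne_projNorm hN hn)

theorem ellNorm_nonneg (hN : IsMatricial N) (p : ℝ≥0∞) {m : ℕ} (ι : Type) [Fintype ι]
    (x : Matrix ι ι (Fin m → V)) : 0 ≤ ellNorm p m N ι x :=
  interp_nonneg (fun x => sumInftyNorm_nonneg (fun _ => hN.nonneg _) x) x

theorem isRelabelInvariant_ellNorm (hN : IsMatricial N) (p : ℝ≥0∞) (m : ℕ) :
    IsRelabelInvariant (ellNorm p m N) :=
  isRelabelInvariant_interp (fun _ _ x => sumInftyNorm_nonneg (fun _ => hN.nonneg _) x)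
    (isRelabelInvariant_sumInftyNorm fun _ => hN.isRelabelInvariant)
    isRelabelInvariant_sumOneNorm

end Seminormed

/-! ### Complete contractivity of `J` and `W` by interpolation -/

section Contractions

variable {k : ℕ} {n : Fin k → ℕ} {d m : ℕ} {S K : Fin k → Type} [∀ i, Fintype (S i)]
  [∀ i, Fintype (K i)] [∀ i, DecidableEq (S i)] [∀ i, DecidableEq (K i)]
  {A : ∀ i, S i → K i → Matrix (Fin d) (Fin (n i)) ℂ}
  {V : Type u} [NormedAddCommGroup V] [NormedSpace ℂ V] {N : MatNorm V}
  {e : (Σ i, S i) ≃ Fin m}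

theorem BddHol.krausIn {c : ℂ → Fin k → ℂ} (hc : ∀ i, BddHol fun z => c z i)
    {f : ℂ → BlockSum n V} (hf : BddHol f) : BddHol fun z => krausIn V e A (c z) (f z) := by
  refine bddHol_pi fun a => bddHol_pi fun b => bddHol_pi fun j => ?_
  refine (hc _).smul ?_
  refine BddHol.sum _ fun κ _ => BddHol.sum _ fun p _ => BddHol.sum _ fun q _ => ?_
  exact (bddHol_const _).smul (((hf.apply _).apply p).apply q)

theorem BddHol.krausOut {c : ℂ → Fin k → ℂ} (hc : ∀ i, BddHol fun z => c z i)
    {f : ℂ → MatEll d m V} (hf : BddHol f) : BddHol fun z => krausOut V e A (c z) (f z) := by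
  refine bddHol_pi fun i => bddHol_pi fun p => bddHol_pi fun q => ?_
  refine (hc _).smul ?_
  refine BddHol.sum _ fun s _ => BddHol.sum _ fun κ _ => BddHol.sum _ fun a _ =>
    BddHol.sum _ fun b _ => ?_
  exact (bddHol_const _).smul (((hf.apply a).apply b).apply _)

theorem smul_krausIn (z : ℂ) (c : Fin k → ℂ) (x : BlockSum n V) :
    z • krausIn V e A c x = krausIn V e A (fun i => z * c i) x := by
  funext a b j
  simp [krausIn, smul_smul]

theorem krausOut_smul (z : ℂ) (c : Fin k → ℂ) (y : MatEll d m V) :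
    krausOut V e A c (z • y) = krausOut V e A (fun i => z * c i) y := by
  rw [map_smul]
  funext a b j
  simp [krausOut, smul_smul]

/-- An admissible function for `x` is pushed forward with the analytic weight `n_i^{-z}`, of modulus
`1` on the left edge and `1 / n_i` on the right. The free scalar `w` leaves room for a power of `d`
when `q` is treated. -/
theorem krausIn_schattenSumNorm_le (hN : IsMatricial N) (hA : IsKrausBasis A) (hn : ∀ i, 0 < n i)
    (p : ℝ≥0∞) {w : ℂ} (hw : ‖w‖ ≤ 1) {ι : Type} [Fintype ι] (x : Matrix ι ι (BlockSum n V)) :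
    minNorm (Fin d) (ellNorm p m N) ι
      (x.map (krausIn V e A fun i => (n i : ℂ) ^ (-(p⁻¹.toReal : ℂ)) * w)) ≤
      schattenSumNorm p n N ι x := by
  refine le_interp fun f C hf hx => ?_
  rw [isAdmissible_iff] at hf
  have hc : ∀ i, BddHol fun z => (n i : ℂ) ^ (-z) * w := fun i =>
    (bddHol_natCast_cpow (hn i) differentiable_id.neg fun z h0 _ => by simpa using h0).smul
      (bddHol_const w)
  refine interp_le (fun x => sumInftyNorm_nonneg (fun _ => hN.nonneg _) x)
    (f := fun z P Q => krausIn V e A (fun i => (n i : ℂ) ^ (-z) * w) (f z P.1 Q.1) P.2 Q.2)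
    (isAdmissible_iff.2 ⟨?_, fun t => ?_, fun t => ?_⟩) ?_
  · exact bddHol_pi fun P => bddHol_pi fun Q =>
      ((BddHol.krausIn hc ((hf.1.apply P.1).apply Q.1)).apply P.2).apply Q.2
  · have hle : ∀ i, ‖(n i : ℂ) ^ (-((t : ℂ) * Complex.I)) * w‖ ≤ 1 := fun i => by
      rw [norm_mul, norm_natCast_cpow (hn i)]
      simpa using hw
    exact (krausIn_sumInfty_le (e := e) hN hA hle (Matrix.of (f (t * Complex.I)))).trans (hf.2.1 t)
  · have hle : ∀ i, ‖(n i : ℂ) ^ (-(1 + (t : ℂ) * Complex.I)) * w‖ ≤ (n i : ℝ)⁻¹ := fun i => by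
      have : (-(1 + (t : ℂ) * Complex.I)).re = -1 := by simp
      rw [norm_mul, norm_natCast_cpow (hn i), this, Real.rpow_neg_one]
      exact mul_le_of_le_one_right (by positivity) hw
    exact (krausIn_sumOne_le (e := e) hN hA hn hle (Matrix.of (f (1 + t * Complex.I)))).trans
      (hf.2.2 t)
  · rw [← hx]
    rfl

/-- Here `x` stays fixed and only the weight `d^{-z}` varies with `z`, so the estimate into
`M_d[ℓ_p]` is all that is needed. -/
theorem completelyContractive_krausIn (hN : IsMatricial N) (hA : IsKrausBasis A) (hd : 0 < d)
    (hn : ∀ i, 0 < n i) (p q : ℝ≥0∞) :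
    CompletelyContractive (schattenSumNorm p n N) (schattenEllNorm q p d m N)
      (krausIn V e A fun i => (n i : ℂ) ^ (-(p⁻¹.toReal : ℂ)) * (d : ℂ) ^ (-(q⁻¹.toReal : ℂ))) := by
  intro ι _ x
  have h0 : (d : ℂ) ≠ 0 := by exact_mod_cast hd.ne'
  refine interp_le (fun x => minNorm_nonneg (ellNorm_nonneg hN p) x)
    (f := fun z r s => krausIn V e A (fun i => (n i : ℂ) ^ (-(p⁻¹.toReal : ℂ)) * (d : ℂ) ^ (-z))
      (x r s)) (isAdmissible_iff.2 ⟨?_, fun t => ?_, fun t => ?_⟩) rfl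
  · refine bddHol_pi fun r => bddHol_pi fun s => BddHol.krausIn (fun i => ?_) (bddHol_const _)
    exact (bddHol_const _).smul
      (bddHol_natCast_cpow hd differentiable_id.neg fun z h0 _ => by simpa using h0)
  · refine krausIn_schattenSumNorm_le hN hA hn p ?_ x
    rw [norm_natCast_cpow hd]
    simp
  -- On the right edge the weight is `d^{-1} d^{-it}`, and `d^{-1}` absorbs the factor `d` from
  -- comparing the projective with the minimal norm.
  · refine (projNorm_le_minNorm hd (fun _ => ellNorm_nonneg hN p _)
      (isRelabelInvariant_ellNorm hN p m) (ellNorm_nonneg hN p _) _).trans ?_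
    refine le_trans (le_of_eq ?_)
      (krausIn_schattenSumNorm_le (e := e) hN hA hn p (w := (d : ℂ) ^ (-((t : ℂ) * Complex.I))) ?_ x)
    · congr 1
      refine Matrix.ext fun r s => ?_
      simp only [Matrix.smul_apply, Matrix.of_apply, Matrix.map_apply, smul_krausIn]
      congr 2
      funext i
      rw [neg_add, Complex.cpow_add _ _ h0, Complex.cpow_neg_one]
      field_simp
    · rw [norm_natCast_cpow hd]
      simp

theorem BddHol.sandwich_tmul {ι τ τ' : Type} [Fintype τ] [Fintype τ'] [Fintype ι]
    {X : Type u} [NormedAddCommGroup X] [NormedSpace ℂ X] (α : Matrix ι (τ × τ') ℂ)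
    (x : Matrix τ τ (Fin d → Fin d → ℂ)) (β : Matrix (τ × τ') ι ℂ) {f : ℂ → τ' → τ' → X}
    (hf : BddHol f) (r s : ι) :
    BddHol fun z => sandwich α (tmul x (Matrix.of (f z))) β r s := by
  refine BddHol.sum _ (f := fun P z => ∑ Q, (α r P * β Q s) • tmul x (Matrix.of (f z)) P Q)
    fun P _ => BddHol.sum _ fun Q _ => (bddHol_const _).smul ?_
  exact bddHol_pi fun a => bddHol_pi fun b => (bddHol_const _).smul ((hf.apply _).apply _)

/-- For a representation `α (x ⊗ y) β` only `y` is replaced by an admissible function; `α`, `x`, `β`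
stay fixed. The weight `n_i^{z-1}` has modulus `1 / n_i` on the left edge and `1` on the right. -/
theorem krausOut_projNorm_le (hN : IsMatricial N) (hA : IsKrausBasis A) (hd : 0 < d)
    (hn : ∀ i, 0 < n i) (p : ℝ≥0∞) {w : ℂ} (hw : ‖w‖ ≤ 1) {ι : Type} [Fintype ι]
    (t : Matrix ι ι (MatEll d m V)) :
    schattenSumNorm p n N ι
      (t.map (krausOut V e A fun i => (n i : ℂ) ^ ((p⁻¹.toReal : ℂ) - 1) * w)) ≤
      projNorm (Fin d) (ellNorm p m N) ι t := by
  refine le_projNorm hd fun l μ α β x y ht => ?_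
  have hK : 0 ≤ opNorm α * traceNorm (Fin d) (Fin l) x * opNorm β :=
    mul_nonneg (mul_nonneg (opNorm_nonneg _) (traceNorm_nonneg _)) (opNorm_nonneg _)
  rw [mul_right_comm]
  refine le_mul_interp hK fun f C hf hy => ?_
  rw [isAdmissible_iff] at hf
  have hc : ∀ i, BddHol fun z => (n i : ℂ) ^ (z - 1) * w := fun i =>
    (bddHol_natCast_cpow (hn i) (differentiable_id.sub_const 1)
      fun z _ h1 => by simpa using h1).smul (bddHol_const w)
  refine interp_le (fun x => sumInftyNorm_nonneg (fun _ x => minNorm_nonneg hN.nonneg x) x)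
    (f := fun z r s => krausOut V e A (fun i => (n i : ℂ) ^ (z - 1) * w)
      (sandwich α (tmul x (Matrix.of (f z))) β r s))
    (isAdmissible_iff.2 ⟨?_, fun t => ?_, fun t => ?_⟩) ?_
  · exact bddHol_pi fun r => bddHol_pi fun s => BddHol.krausOut hc (hf.1.sandwich_tmul α x β r s)
  · refine (krausOut_sumInfty_le hN hA hd hn (fun i => ?_)
      (sandwich α (tmul x (Matrix.of (f (t * Complex.I)))) β)).trans ?_
    · rw [norm_mul, norm_natCast_cpow (hn i)]
      have : ((t : ℂ) * Complex.I - 1).re = -1 := by simp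
      rw [this, Real.rpow_neg_one]
      exact mul_le_of_le_one_right (by positivity) hw
    · refine (projNorm_sandwich_le
        (fun _ y => sumInftyNorm_nonneg (fun _ => hN.nonneg _) y) α β x _).trans ?_
      rw [mul_right_comm]
      exact mul_le_mul_of_nonneg_left (hf.2.1 t) hK
  · refine (krausOut_sumOne_le hN hA hd (fun i => ?_)
      (sandwich α (tmul x (Matrix.of (f (1 + t * Complex.I)))) β)).trans ?_
    · rw [norm_mul, norm_natCast_cpow (hn i)]
      simpa using hw
    · refine (projNorm_sandwich_le (fun _ y => sumOneNorm_nonneg y) α β x _).trans ?_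
      rw [mul_right_comm]
      exact mul_le_mul_of_nonneg_left (hf.2.2 t) hK
  · rw [ht, ← hy]
    rfl

theorem toReal_inv_le_one {p : ℝ≥0∞} (hp : 1 ≤ p) : p⁻¹.toReal ≤ 1 := by
  have := ENNReal.toReal_mono ENNReal.one_ne_top (ENNReal.inv_le_one.2 hp)
  simpa using this

/-- The target norm does not vary with `q`, so the three lines theorem for this one seminorm applies
to the image of an admissible function under `d^{z-1} W`. -/
theorem completelyContractive_krausOut (hN : IsMatricial N) (hA : IsKrausBasis A) (hd : 0 < d)
    (hn : ∀ i, 0 < n i) (p : ℝ≥0∞) {q : ℝ≥0∞} (hq : 1 ≤ q) :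
    CompletelyContractive (schattenEllNorm q p d m N) (schattenSumNorm p n N)
      (krausOut V e A fun i =>
        (n i : ℂ) ^ ((p⁻¹.toReal : ℂ) - 1) * (d : ℂ) ^ ((q⁻¹.toReal : ℂ) - 1)) := by
  intro ι _ y
  have h0 : (d : ℂ) ≠ 0 := by exact_mod_cast hd.ne'
  refine le_interp fun f C hf hy => ?_
  rw [isAdmissible_iff] at hf
  rw [← hy]
  have hc : ∀ i, BddHol fun z => (n i : ℂ) ^ ((p⁻¹.toReal : ℂ) - 1) * (d : ℂ) ^ (z - 1) := fun i =>
    (bddHol_const _).smul (bddHol_natCast_cpow hd (differentiable_id.sub_const 1)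
      fun z _ h1 => by simpa using h1)
  refine (isSeminormed_schattenSumNorm hN hn p).le_of_boundary
    (f := fun z r s => krausOut V e A
      (fun i => (n i : ℂ) ^ ((p⁻¹.toReal : ℂ) - 1) * (d : ℂ) ^ (z - 1)) (f z r s))
    (bddHol_pi fun r => bddHol_pi fun s => BddHol.krausOut hc ((hf.1.apply r).apply s))
    (fun t => ?_) (fun t => ?_) ENNReal.toReal_nonneg (toReal_inv_le_one hq)
  -- On the left edge `d^{z-1} = d^{-1} d^{it}`; moving `d^{-1}` into the argument bounds its
  -- projective norm by the minimal norm of the unscaled argument.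
  · have h := krausOut_projNorm_le (e := e) hN hA hd hn p
      (w := (d : ℂ) ^ ((t : ℂ) * Complex.I)) (by rw [norm_natCast_cpow hd]; simp)
      ((d : ℂ)⁻¹ • Matrix.of (f (t * Complex.I)))
    have h1 := projNorm_le_minNorm (ι := ι) hd (fun _ => ellNorm_nonneg hN p _)
      (isRelabelInvariant_ellNorm hN p m) (ellNorm_nonneg hN p _)
      ((d : ℂ)⁻¹ • Matrix.of (f (t * Complex.I)))
    rw [smul_smul, mul_inv_cancel₀ h0, one_smul] at h1
    refine le_trans (le_of_eq ?_) ((h.trans h1).trans (hf.2.1 t))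
    congr 1
    refine Matrix.ext fun r s => ?_
    simp only [Matrix.smul_apply, Matrix.of_apply, Matrix.map_apply, krausOut_smul]
    congr 2
    funext i
    rw [Complex.cpow_sub _ _ h0, Complex.cpow_one]
    field_simp
  · refine le_trans (krausOut_projNorm_le hN hA hd hn p ?_ (Matrix.of (f (1 + t * Complex.I))))
      (hf.2.2 t)
    rw [norm_natCast_cpow hd]
    simp

end Contractions
-- Weyl operators and the Kraus operators
section Basis

/-- The Weyl operators: an orthogonal basis of `M_n` of unitary matrices. -/
theorem exists_unitary_basis {n : ℕ} (hn : 0 < n) :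
    ∃ U : Fin n × Fin n → Fin n → Fin n → ℂ,
      (∀ s p q, ∑ a, star (U s a p) * U s a q = if p = q then 1 else 0) ∧
      (∀ s s', ∑ a, ∑ p, star (U s a p) * U s' a p = if s = s' then (n : ℂ) else 0) := by
  have : NeZero n := ⟨hn.ne'⟩
  let ψ : AddChar (ZMod n) ℂ := ZMod.stdAddChar
  have hψ : ψ.IsPrimitive := ZMod.isPrimitive_stdAddChar n
  have hstar : ∀ x y, star (ψ x) * ψ y = ψ (y - x) := fun x y => by
    rw [sub_eq_add_neg, add_comm, AddChar.map_add_eq_mul, AddChar.map_neg_eq_conj]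
    rfl
  let g : Fin n ≃ ZMod n := (ZMod.finEquiv n).toEquiv
  -- A shift by `s.1` composed with multiplication by the character of frequency `s.2`.
  refine ⟨fun s a p => if g a = g p + g s.1 then ψ (g p * g s.2) else 0, fun s p q => ?_,
    fun s s' => ?_⟩
  · rw [← Equiv.sum_comp g.symm]
    simp only [Equiv.apply_symm_apply, apply_ite star, star_zero, mul_ite, ite_mul, zero_mul,
      mul_zero, Finset.sum_ite_eq', Finset.mem_univ, if_true, add_left_inj, hstar]
    by_cases h : p = q
    · simp [h]
    · have : ¬ g q = g p := fun h' => h (g.injective h').symm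
      simp [h, this]
  · rw [Finset.sum_comm, ← Equiv.sum_comp g.symm]
    have h1 : ∀ p : ZMod n, ∑ a, star (if g a = g (g.symm p) + g s.1 then
        ψ (g (g.symm p) * g s.2) else 0) *
        (if g a = g (g.symm p) + g s'.1 then ψ (g (g.symm p) * g s'.2) else 0) =
        if g s.1 = g s'.1 then ψ (p * (g s'.2 - g s.2)) else 0 := by
      intro p
      rw [← Equiv.sum_comp g.symm]
      simp only [Equiv.apply_symm_apply, apply_ite star, star_zero, mul_ite, ite_mul, zero_mul,
        mul_zero, Finset.sum_ite_eq', Finset.mem_univ, if_true, add_right_inj, hstar, mul_sub]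
      simp only [eq_comm]
    simp only [h1]
    -- Equal shifts leave a sum of a character over `ZMod n`, which vanishes unless the frequencies
    -- agree; different shifts have disjoint supports.
    by_cases h : g s.1 = g s'.1
    · simp only [h, if_true, AddChar.sum_mulShift _ hψ, sub_eq_zero, ZMod.card]
      have h2 : s = s' ↔ g s'.2 = g s.2 := by
        rw [Prod.ext_iff, g.apply_eq_iff_eq]
        exact ⟨fun h' => h'.2.symm, fun h' => ⟨g.injective h, h'.symm⟩⟩
      simp [h2]
    · have h2 : s ≠ s' := fun h' => h (by rw [h'])
      simp [h, h2]

/-- Under `ℂ^d = ℂ^{n_i} ⊗ ℂ^{d / n_i}`, the operator `A_{sκ}` is `v ↦ U_s v ⊗ e_κ`. -/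
theorem exists_isKrausBasis {k : ℕ} {n : Fin k → ℕ} {d : ℕ} (hn : ∀ i, 0 < n i)
    (hd : ∀ i, n i ∣ d) :
    ∃ A : ∀ i, Fin (n i) × Fin (n i) → Fin (d / n i) → Matrix (Fin d) (Fin (n i)) ℂ,
      IsKrausBasis A := by
  choose U hU1 hU2 using fun i => exists_unitary_basis (hn i)
  have σ : ∀ i, Fin d ≃ Fin (n i) × Fin (d / n i) := fun i =>
    Fintype.equivOfCardEq (by simp [Nat.mul_div_cancel' (hd i)])
  refine ⟨fun i s κ => Matrix.of fun a p =>
    if (σ i a).2 = κ then U i s (σ i a).1 p else 0, fun i s κ κ' p q => ?_,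
    fun i s κ s' κ' => ?_⟩
  · rw [← Equiv.sum_comp (σ i).symm]
    simp only [Matrix.of_apply, Equiv.apply_symm_apply, Fintype.sum_prod_type, apply_ite star,
      star_zero, mul_ite, ite_mul, zero_mul, mul_zero, Finset.sum_ite_eq',
      Finset.mem_univ, if_true]
    by_cases h : κ = κ'
    · simpa [h] using hU1 i s p q
    · simp [h, Ne.symm h]
  · rw [← Equiv.sum_comp (σ i).symm, Fintype.sum_prod_type, Finset.sum_comm]
    by_cases h : κ = κ'
    · subst h
      rw [Finset.sum_eq_single κ]
      · simpa using hU2 i s s'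
      · intro c _ hc
        simp [hc]
      · simp
    · refine (Finset.sum_eq_zero fun c _ => Finset.sum_eq_zero fun a _ =>
        Finset.sum_eq_zero fun p _ => ?_).trans (by simp [h])
      by_cases hc : c = κ
      · simp [hc, h]
      · simp [hc]

end Basis

/-! ### The composition `W ∘ J`, positivity and weights -/

section Algebra

variable {k : ℕ} {n : Fin k → ℕ} {d m : ℕ} {S K : Fin k → Type} [∀ i, Fintype (S i)]
  [∀ i, Fintype (K i)] [∀ i, DecidableEq (S i)] [∀ i, DecidableEq (K i)]
  {A : ∀ i, S i → K i → Matrix (Fin d) (Fin (n i)) ℂ} {e : (Σ i, S i) ≃ Fin m}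

/-- Since `A_{sκ}^* A_{sκ'}` is `δ_{κκ'}` times the identity, each pair `(s, κ)` returns `x_i`
exactly once; the weights cancel the number of pairs. -/
theorem krausOut_krausIn {V : Type u} [AddCommGroup V] [Module ℂ V] (hA : IsKrausBasis A)
    {c c' : Fin k → ℂ} (hc : ∀ i, c' i * (Fintype.card (S i) * Fintype.card (K i)) * c i = 1) :
    krausOut V e A c' ∘ₗ krausIn V e A c = LinearMap.id := by
  refine LinearMap.ext fun x => ?_
  funext i p q
  have key : ∀ s κ, ∑ a, ∑ b, (star (A i s κ a p) * A i s κ b q) •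
      (∑ κ', ∑ p', ∑ q', (A i s κ' a p' * star (A i s κ' b q')) • x i p' q') = x i p q := by
    intro s κ
    have h1 : ∀ κ' p' q', ∑ a, ∑ b, ((star (A i s κ a p) * A i s κ b q) *
        (A i s κ' a p' * star (A i s κ' b q'))) =
        (if κ = κ' ∧ p = p' then 1 else 0) * (if κ = κ' ∧ q = q' then 1 else 0) := by
      intro κ' p' q'
      have h2 : (if κ = κ' ∧ q = q' then (1 : ℂ) else 0) =
          star (∑ b, star (A i s κ b q) * A i s κ' b q') := by
        rw [hA.isometry]
        split_ifs <;> simp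
      rw [← hA.isometry i s κ κ' p p', h2, star_sum, Finset.sum_mul_sum]
      refine Finset.sum_congr rfl fun a _ => Finset.sum_congr rfl fun b _ => ?_
      rw [star_mul', star_star]
      ring
    calc _ = ∑ a, ∑ b, ∑ κ', ∑ p', ∑ q', ((star (A i s κ a p) * A i s κ b q) *
          (A i s κ' a p' * star (A i s κ' b q'))) • x i p' q' := by
          simp only [Finset.smul_sum, smul_smul]
      _ = ∑ κ', ∑ p', ∑ q', ∑ a, ∑ b, ((star (A i s κ a p) * A i s κ b q) *
          (A i s κ' a p' * star (A i s κ' b q'))) • x i p' q' := by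
          rw [sum_comm_pairs]
          refine Finset.sum_congr rfl fun κ' _ => Finset.sum_congr rfl fun p' _ => ?_
          exact sum_comm_triple _
      _ = _ := by
          simp only [← Finset.sum_smul, h1]
          simp [ite_and]
  have h3 : (krausOut V e A c' ∘ₗ krausIn V e A c) x i p q =
      c' i • ∑ s, ∑ κ, c i • ∑ a, ∑ b, (star (A i s κ a p) * A i s κ b q) •
      (∑ κ', ∑ p', ∑ q', (A i s κ' a p' * star (A i s κ' b q')) • x i p' q') := by
    simp only [krausOut, krausIn, LinearMap.comp_apply, LinearMap.coe_mk, AddHom.coe_mk,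
      Finset.smul_sum (r := c i)]
    congr 1
    refine Finset.sum_congr rfl fun s _ => Finset.sum_congr rfl fun κ _ =>
      Finset.sum_congr rfl fun a _ => Finset.sum_congr rfl fun b _ => ?_
    rw [Equiv.symm_apply_apply, smul_comm]
  rw [h3]
  simp only [key, Finset.sum_const, Finset.card_univ, ← Nat.cast_smul_eq_nsmul ℂ, smul_smul]
  have h4 : c' i * (Fintype.card (S i) * (Fintype.card (K i) * c i)) = 1 := by
    rw [← hc i]
    ring
  rw [h4, one_smul]
  rfl

theorem krausIn_smul_const {V : Type u} [AddCommGroup V] [Module ℂ V] (c : Fin k → ℂ)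
    (x : BlockSum n ℂ) (v : V) :
    krausIn V e A c (fun i a b => x i a b • v) = fun a b j => krausIn ℂ e A c x a b j • v := by
  funext a b j
  simp only [krausIn, LinearMap.coe_mk, AddHom.coe_mk, smul_smul, Finset.smul_sum, Finset.sum_smul,
    smul_eq_mul, Finset.mul_sum, mul_assoc]

theorem krausOut_smul_const {V : Type u} [AddCommGroup V] [Module ℂ V] (c : Fin k → ℂ)
    (y : MatEll d m ℂ) (v : V) :
    krausOut V e A c (fun a b j => y a b j • v) = fun i a b => krausOut ℂ e A c y i a b • v := by
  funext i a b
  simp only [krausOut, LinearMap.coe_mk, AddHom.coe_mk, smul_smul, Finset.smul_sum,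
    Finset.sum_smul, smul_eq_mul, Finset.mul_sum, mul_assoc]

theorem idTensor_conjTranspose {ν τ ι : Type} (L : Matrix ν τ ℂ) :
    (idTensor ι L).conjTranspose = idTensor ι L.conjTranspose := by
  ext P Q
  simp only [idTensor, Matrix.conjTranspose_apply, Matrix.of_apply, apply_ite star, star_zero]
  by_cases h : P.1 = Q.1
  · simp [h]
  · simp [h, Ne.symm h]

theorem idTensor_mul_mul_apply {ν ν' τ τ' ι : Type} [Fintype ι] [Fintype τ] [Fintype τ']
    (L : Matrix ν τ ℂ) (X : Matrix (ι × τ) (ι × τ') ℂ) (R : Matrix τ' ν' ℂ) (P : ι × ν)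
    (Q : ι × ν') : (idTensor ι L * X * idTensor ι R) P Q =
      ∑ a, ∑ b, L P.2 a * R b Q.2 * X (P.1, a) (Q.1, b) := by
  simp only [Matrix.mul_apply, idTensor, Matrix.of_apply, Fintype.sum_prod_type, ite_mul, mul_ite,
    zero_mul, mul_zero]
  rw [Finset.sum_eq_single Q.1, Finset.sum_comm]
  · refine Finset.sum_congr rfl fun b _ => ?_
    rw [if_pos rfl, Finset.sum_eq_single P.1, Finset.sum_mul]
    · exact Finset.sum_congr rfl fun a _ => by rw [if_pos rfl]; ring
    · exact fun r _ hr => by simp [hr.symm]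
    · simp
  · exact fun r _ hr => by simp [hr]
  · simp

open scoped ComplexOrder in
theorem completelyPositive_krausIn {c : Fin k → ℂ} (hc : ∀ i, 0 ≤ c i) :
    CompletelyPositive (blockSumCone n) (matEllCone d m) (krausIn ℂ e A c) := by
  intro ι _ x hx j
  obtain ⟨⟨i, s⟩, rfl⟩ := e.surjective j
  have h := (Matrix.posSemidef_sum Finset.univ fun κ _ =>
    (hx i).mul_mul_conjTranspose_same (idTensor ι (A i s κ))).smul (hc i)
  convert h using 1
  refine Matrix.ext fun P Q => ?_
  simp only [krausIn, Matrix.of_apply, Matrix.map_apply, LinearMap.coe_mk, AddHom.coe_mk,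
    Matrix.smul_apply, Matrix.sum_apply, idTensor_conjTranspose, idTensor_mul_mul_apply,
    Matrix.conjTranspose_apply, smul_eq_mul]
  rw [Equiv.symm_apply_apply]

open scoped ComplexOrder in
theorem completelyPositive_krausOut {c : Fin k → ℂ} (hc : ∀ i, 0 ≤ c i) :
    CompletelyPositive (matEllCone d m) (blockSumCone n) (krausOut ℂ e A c) := by
  intro ι _ y hy i
  have h := (Matrix.posSemidef_sum Finset.univ fun s _ =>
    Matrix.posSemidef_sum Finset.univ fun κ _ =>
    (hy (e ⟨i, s⟩)).conjTranspose_mul_mul_same (idTensor ι (A i s κ))).smul (hc i)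
  convert h using 1
  refine Matrix.ext fun P Q => ?_
  simp only [krausOut, Matrix.of_apply, Matrix.map_apply, LinearMap.coe_mk, AddHom.coe_mk,
    Matrix.smul_apply, Matrix.sum_apply, idTensor_conjTranspose, idTensor_mul_mul_apply,
    Matrix.conjTranspose_apply, smul_eq_mul]

open scoped ComplexOrder in
theorem natCast_cpow_nonneg (n : ℕ) (x : ℝ) : 0 ≤ (n : ℂ) ^ (x : ℂ) := by
  rw [← Complex.ofReal_natCast, ← Complex.ofReal_cpow (Nat.cast_nonneg n)]
  exact Complex.zero_le_real.2 (by positivity)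

open scoped ComplexOrder in
theorem weightIn_nonneg (a b : ℕ) (x y : ℝ) :
    0 ≤ (a : ℂ) ^ (-(x : ℂ)) * (b : ℂ) ^ (-(y : ℂ)) := by
  have h1 := natCast_cpow_nonneg a (-x)
  have h2 := natCast_cpow_nonneg b (-y)
  push_cast at h1 h2
  exact mul_nonneg h1 h2

open scoped ComplexOrder in
theorem weightOut_nonneg (a b : ℕ) (x y : ℝ) :
    0 ≤ (a : ℂ) ^ ((x : ℂ) - 1) * (b : ℂ) ^ ((y : ℂ) - 1) := by
  have h1 := natCast_cpow_nonneg a (x - 1)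
  have h2 := natCast_cpow_nonneg b (y - 1)
  push_cast at h1 h2
  exact mul_nonneg h1 h2

theorem weightOut_mul_weightIn {a b : ℕ} (ha : 0 < a) (hb : 0 < b) (hab : a ∣ b) (x y : ℂ) :
    (a : ℂ) ^ (x - 1) * (b : ℂ) ^ (y - 1) *
      (Fintype.card (Fin a × Fin a) * Fintype.card (Fin (b / a))) *
      ((a : ℂ) ^ (-x) * (b : ℂ) ^ (-y)) = 1 := by
  have ha0 : (a : ℂ) ≠ 0 := by exact_mod_cast ha.ne'
  have hb0 : (b : ℂ) ≠ 0 := by exact_mod_cast hb.ne'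
  have hdiv : (a : ℂ) * ((b / a : ℕ) : ℂ) = b := by
    exact_mod_cast Nat.mul_div_cancel' hab
  have h1 : (a : ℂ) ^ (x - 1) * (a : ℂ) ^ (-x) = (a : ℂ)⁻¹ := by
    rw [← Complex.cpow_add _ _ ha0, ← Complex.cpow_neg_one]
    congr 1
    ring
  have h2 : (b : ℂ) ^ (y - 1) * (b : ℂ) ^ (-y) = (b : ℂ)⁻¹ := by
    rw [← Complex.cpow_add _ _ hb0, ← Complex.cpow_neg_one]
    congr 1
    ring
  simp only [Fintype.card_prod, Fintype.card_fin, Nat.cast_mul]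
  calc _ = ((a : ℂ) ^ (x - 1) * (a : ℂ) ^ (-x)) * ((b : ℂ) ^ (y - 1) * (b : ℂ) ^ (-y)) * a *
        ((a : ℂ) * ((b / a : ℕ) : ℂ)) := by ring
    _ = 1 := by
      rw [h1, h2, hdiv]
      field_simp

end Algebra

/-! ### Contractive retracts -/

section Retract

variable {V : Type u} [AddCommGroup V] [Module ℂ V] {W : Type v} [AddCommGroup W] [Module ℂ W]
  {N : MatNorm V} {N' : MatNorm W} {J : V →ₗ[ℂ] W} {T : W →ₗ[ℂ] V}

/-- A contraction with a contractive left inverse cannot decrease norms. -/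
theorem CompletelyContractive.completeIsometry (hJ : CompletelyContractive N N' J)
    (hT : CompletelyContractive N' N T) (h : T ∘ₗ J = LinearMap.id) : CompleteIsometry N N' J := by
  intro ι _ x
  refine le_antisymm (hJ ι x) ?_
  have h1 := hT ι (x.map J)
  have h2 : (x.map J).map T = x := by
    ext r s
    exact LinearMap.congr_fun h (x r s)
  rwa [h2] at h1

theorem CompletelyContractive.completelyComplemented (hJ : CompletelyContractive N N' J)
    (hT : CompletelyContractive N' N T) (h : T ∘ₗ J = LinearMap.id) :
    CompletelyComplemented N' (LinearMap.range J) := by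
  refine ⟨J ∘ₗ T, fun ι _ x => (hJ ι (x.map T)).trans (hT ι x), ?_, ?_⟩
  · rw [LinearMap.comp_assoc, ← LinearMap.comp_assoc T J T, h, LinearMap.id_comp]
  · refine LinearMap.range_comp_of_range_eq_top J (LinearMap.range_eq_top.2 fun v => ?_)
    exact ⟨J v, LinearMap.congr_fun h v⟩

end Retract
end OpSpace

open OpSpace
/-- Scalar part: `J` and `W`. Vector-valued part: for every operator space, that is, every closed
subspace `E` of some `B(H)`, the amplifications `JE = J ⊗ id_E` and `WE = W ⊗ id_E`. -/
theorem theorem1p1 (p q : ℝ≥0∞) (hp : 1 ≤ p) (hq : 1 ≤ q) {k : ℕ} (n : Fin k → ℕ)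
    (hn : ∀ i, 0 < n i) (d m : ℕ) (hd : d = Finset.univ.lcm n) (hm : m = ∑ i, n i ^ 2) :
    ∃ (J : BlockSum n ℂ →ₗ[ℂ] MatEll d m ℂ) (W : MatEll d m ℂ →ₗ[ℂ] BlockSum n ℂ),
      CompletelyPositive (blockSumCone n) (matEllCone d m) J ∧
      CompletelyPositive (matEllCone d m) (blockSumCone n) W ∧
      CompleteIsometry (schattenSumNorm p n scalarNorm) (schattenEllNorm q p d m scalarNorm) J ∧
      CompletelyContractive (schattenEllNorm q p d m scalarNorm)
        (schattenSumNorm p n scalarNorm) W ∧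
      W ∘ₗ J = LinearMap.id ∧
      ∀ (H : Type u) [NormedAddCommGroup H] [InnerProductSpace ℂ H] [CompleteSpace H]
        (E : Submodule ℂ (H →L[ℂ] H)), IsClosed (E : Set (H →L[ℂ] H)) →
        ∃ (JE : BlockSum n E →ₗ[ℂ] MatEll d m E) (WE : MatEll d m E →ₗ[ℂ] BlockSum n E),
          (∀ (x : BlockSum n ℂ) (e : E),
            JE (fun i a b => x i a b • e) = fun a b j => J x a b j • e) ∧
          (∀ (y : MatEll d m ℂ) (e : E),
            WE (fun a b j => y a b j • e) = fun i a b => W y i a b • e) ∧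
          CompleteIsometry (schattenSumNorm p n (subspaceNorm E))
            (schattenEllNorm q p d m (subspaceNorm E)) JE ∧
          CompletelyContractive (schattenEllNorm q p d m (subspaceNorm E))
            (schattenSumNorm p n (subspaceNorm E)) WE ∧
          WE ∘ₗ JE = LinearMap.id ∧
          CompletelyComplemented (schattenEllNorm q p d m (subspaceNorm E))
            (LinearMap.range JE) := by
  have hdvd : ∀ i, n i ∣ d := fun i => hd ▸ Finset.dvd_lcm (Finset.mem_univ i)
  obtain ⟨A, hA⟩ := exists_isKrausBasis hn hdvd
  have hdpos : 0 < d := by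
    rw [hd, Nat.pos_iff_ne_zero, Ne, Finset.lcm_eq_zero_iff]
    rintro ⟨i, -, hi⟩
    exact (hn i).ne' hi
  -- The coordinates of `ℓ_p^m` are labelled by the Weyl operators of all blocks, `n_i ^ 2` for the
  -- block `i`; any enumeration will do.
  have e : (Σ i, Fin (n i) × Fin (n i)) ≃ Fin m :=
    Fintype.equivFinOfCardEq (by simp [hm, sq])
  have hcc := fun i => weightOut_mul_weightIn (hn i) hdpos (hdvd i) p⁻¹.toReal q⁻¹.toReal
  have hJ := completelyContractive_krausIn (e := e) isMatricial_scalarNorm hA hdpos hn p q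
  have hW := completelyContractive_krausOut (e := e) isMatricial_scalarNorm hA hdpos hn p hq
  refine ⟨_, _, completelyPositive_krausIn fun i => weightIn_nonneg _ _ _ _,
    completelyPositive_krausOut fun i => weightOut_nonneg _ _ _ _, hJ.completeIsometry hW (krausOut_krausIn hA hcc), hW,
    krausOut_krausIn hA hcc, ?_⟩
  intro H _ _ _ E _
  have hJE := completelyContractive_krausIn (e := e) (isMatricial_subspaceNorm E) hA hdpos hn p q
  have hWE := completelyContractive_krausOut (e := e) (isMatricial_subspaceNorm E) hA hdpos hn p hq
  exact ⟨_, _, krausIn_smul_const _, krausOut_smul_const _,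
    hJE.completeIsometry hWE (krausOut_krausIn hA hcc), hWE, krausOut_krausIn hA hcc,
    hJE.completelyComplemented hWE (krausOut_krausIn hA hcc)⟩
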